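/- A (finite) geometric polyhedron $P$ in Euclidean space $\mathbb{E}^3$ consists of a finite set of points (vertices), a set of line segments joining vertices (edges), and a set of polygons made up of these edges (faces; a polygon has $n\ge 3$ distinct vertices and is the closed edge path through them), such that the edge graph is connected, the vertex-figure at every vertex $v$ (the graph on the neighbours of $v$ in which $u,w$ are joined when $uv$ and $vw$ are edges of a common face) is connected, and each edge lies in exactly two faces. Let $\Gamma(P)$ be the automorphism group of the partially ordered set of vertices, edges and faces of $P$, let $G(P)$ be the group of isometries of $\mathbb{E}^3$ mapping $P$ to itself, viewed as a subgroup of $\Gamma(P)$, and let $G^{+}(P)$ be the subgroup of proper isometries in $G(P)$. The polyhedron $P$ is a regular polyhedron of index $2$ if $\Gamma(P)$ is transitive on the flags of $P$ and $|\Gamma(P):G(P)|=2$. Let $P$ be a regular polyhedron of index $2$ whose vertices form exactly two orbits under $G(P)$, namely the vertex set of a Platonic solid $S$ with center $o$ and the vertex set of $S^\diamond$, where either $S^\diamond=\lambda S$ (aligned), or $S$ is a tetrahedron and $S^\diamond=-\lambda S$ (opposed), for some $\lambda>0$; here $\pm\lambda S$ denotes the image of $S$ under the homothety with center $o$ and ratio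 $\pm\lambda$. For a vertex $v$ of $S$ let $v^\diamond$ be its image under this homothety. For vertices $v,w$ of $S$, the length of a segment $\{v,w^\diamond\}$ is the length of a shortest path from $v$ to $w$ along edges of $S$ if $S^\diamond=\lambda S$, and the length of a shortest path from $v$ to the point $-w$ of $-S$ (the point on the ray from $o$ through $w^\diamond$) along the edges of the cube whose vertices are those of $S$ and $-S$ if $S^\diamond=-\lambda S$. We say that $P$ has edge length $\ell$ if every edge of $P$ is of the form $\{v,w^\diamond\}$ with $v,w$ vertices of $S$, and has length $\ell$. Then: 1. $S$ is not a cube. 2. If $S$ is a tetrahedron or an octahedron, then $P$ has edge length $1$. 3. If $S$ is an icosahedron, then $P$ has edge length $1$ or edge length $2$. 4. If $S$ is a dodecahedron, then $P$ has edge length $1$ or edge length $4$. 5. In every case $G^{+}(P)$ is simply edge-transitive: for any two edges $e,e'$ of $P$ there is exactly one element of $G^{+}(P)$ that maps $e$ to $e'$. -/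

import Mathlib

/-- Euclidean 3-space. -/
abbrev E3 : Type := EuclideanSpace ℝ (Fin 3)

/-- A polygon `(v₁, …, vₙ)` with `n ≥ 3` distinct vertices, recorded as the set of its edges. A
segment is recorded as the unordered pair of its endpoints. -/
def IsPolygon (F : Set (Sym2 E3)) : Prop :=
  ∃ n : ℕ, 3 ≤ n ∧ ∃ v : ZMod n → E3, Function.Injective v ∧
    F = Set.range fun i => s(v i, v (i + 1))

/-- The graph on the point set `V` whose edges are the segments in `E`. -/
def segmentGraph (V : Set E3) (E : Set (Sym2 E3)) : SimpleGraph V where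
  Adj u w := u ≠ w ∧ s((u : E3), (w : E3)) ∈ E
  symm.symm _ _ h := ⟨h.1.symm, Sym2.eq_swap ▸ h.2⟩
  loopless.irrefl _ h := h.1 rfl

/-- The vertex-figure at `v`: its vertices are the neighbours of `v`, and `u`, `w` are joined when
`uv` and `vw` are edges of a common face. -/
def vertexFigure (E : Set (Sym2 E3)) (𝓕 : Set (Set (Sym2 E3))) (v : E3) :
    SimpleGraph {u : E3 // s(u, v) ∈ E} where
  Adj u w := u ≠ w ∧ ∃ F ∈ 𝓕, s((u : E3), v) ∈ F ∧ s((w : E3), v) ∈ F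
  symm.symm _ _ h := ⟨h.1.symm, h.2.imp fun _ hF => ⟨hF.1, hF.2.2, hF.2.1⟩⟩
  loopless.irrefl _ h := h.1 rfl

/-- A finite geometric polyhedron in Euclidean 3-space. -/
structure GeometricPolyhedron where
  /-- the vertices -/
  verts : Set E3
  /-- the edges -/
  edges : Set (Sym2 E3)
  /-- the faces -/
  faces : Set (Set (Sym2 E3))
  finite_verts : verts.Finite
  edge_not_diag : ∀ e ∈ edges, ¬ e.IsDiag
  edge_verts : ∀ e ∈ edges, ∀ v ∈ e, v ∈ verts
  face_polygon : ∀ F ∈ faces, IsPolygon F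
  face_edges : ∀ F ∈ faces, F ⊆ edges
  connected : (segmentGraph verts edges).Connected
  vertexFigure_connected : ∀ v ∈ verts, (vertexFigure edges faces v).Connected
  two_faces : ∀ e ∈ edges, {F ∈ faces | e ∈ F}.ncard = 2

namespace GeometricPolyhedron

/-- The proper elements of the underlying abstract polyhedron. -/
inductive Cell (P : GeometricPolyhedron) : Type
  | vertex (v : P.verts) : Cell P
  | edge (e : P.edges) : Cell P
  | face (F : P.faces) : Cell P

variable {P : GeometricPolyhedron}

/-- Incidence of the proper elements. -/
def Cell.Le : P.Cell → P.Cell → Prop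
  | .vertex v, .vertex w => v = w
  | .vertex v, .edge e => (v : E3) ∈ (e : Sym2 E3)
  | .vertex v, .face F => ∃ e ∈ (F : Set (Sym2 E3)), (v : E3) ∈ e
  | .edge e, .edge e' => e = e'
  | .edge e, .face F => (e : Sym2 E3) ∈ (F : Set (Sym2 E3))
  | .face F, .face F' => F = F'
  | _, _ => False

/-- The underlying abstract polyhedron, as the partially ordered set of its proper elements. -/
instance : PartialOrder P.Cell where
  le := Cell.Le
  le_refl c := by cases c <;> simp [Cell.Le]
  le_trans a b c hab hbc := by
    cases a <;> cases b <;> cases c <;> simp_all [Cell.Le]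
    exact ⟨_, hbc, hab⟩
  le_antisymm a b hab hba := by
    cases a <;> cases b <;> simp_all [Cell.Le]

/-- A flag: a vertex, an edge and a face, all mutually incident. -/
structure FlagOf (P : GeometricPolyhedron) where
  v : P.verts
  e : P.edges
  F : P.faces
  vertex_le_edge : Cell.vertex v ≤ Cell.edge e
  edge_le_face : Cell.edge e ≤ Cell.face F

/-- The combinatorial automorphism group `Γ(P)`. -/
abbrev AutGroup (P : GeometricPolyhedron) : Type := P.Cell ≃o P.Cell

/-- Combinatorial regularity: `Γ(P)` is transitive on the flags. -/
def IsCombRegular (P : GeometricPolyhedron) : Prop :=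
  ∀ Φ Ψ : P.FlagOf, ∃ γ : P.AutGroup,
    γ (.vertex Φ.v) = .vertex Ψ.v ∧ γ (.edge Φ.e) = .edge Ψ.e ∧ γ (.face Φ.F) = .face Ψ.F

/-- `g` maps `P` to itself. -/
def Preserves (P : GeometricPolyhedron) (g : E3 ≃ᵃⁱ[ℝ] E3) : Prop :=
  (∀ v, g v ∈ P.verts ↔ v ∈ P.verts) ∧ (∀ e, Sym2.map g e ∈ P.edges ↔ e ∈ P.edges) ∧
    (∀ F, Sym2.map g '' F ∈ P.faces ↔ F ∈ P.faces)

theorem sym2_map_mul (g h : E3 ≃ᵃⁱ[ℝ] E3) (e : Sym2 E3) :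
    Sym2.map (g * h) e = Sym2.map g (Sym2.map h e) := by
  rw [Sym2.map_map]; rfl

theorem sym2_map_one (e : Sym2 E3) : Sym2.map (1 : E3 ≃ᵃⁱ[ℝ] E3) e = e := by
  have : ⇑(1 : E3 ≃ᵃⁱ[ℝ] E3) = id := rfl
  rw [this, Sym2.map_id]; rfl

theorem image_map_mul (g h : E3 ≃ᵃⁱ[ℝ] E3) (F : Set (Sym2 E3)) :
    Sym2.map (g * h) '' F = Sym2.map g '' (Sym2.map h '' F) := by
  rw [Set.image_image]; exact Set.image_congr fun e _ => sym2_map_mul g h e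

theorem image_map_one (F : Set (Sym2 E3)) : Sym2.map (1 : E3 ≃ᵃⁱ[ℝ] E3) '' F = F := by
  rw [Set.image_congr fun e _ => sym2_map_one e, Set.image_id']

/-- The geometric symmetry group `G(P)`. -/
def symmetryGroup (P : GeometricPolyhedron) : Subgroup (E3 ≃ᵃⁱ[ℝ] E3) where
  carrier := {g | P.Preserves g}
  one_mem' := ⟨fun _ => Iff.rfl, fun e => by rw [sym2_map_one], fun F => by rw [image_map_one]⟩
  mul_mem' {g h} hg hh := ⟨fun v => (hg.1 (h v)).trans (hh.1 v),
    fun e => by rw [sym2_map_mul]; exact (hg.2.1 _).trans (hh.2.1 e),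
    fun F => by rw [image_map_mul]; exact (hg.2.2 _).trans (hh.2.2 F)⟩
  inv_mem' {g} hg := by
    refine ⟨fun v => ?_, fun e => ?_, fun F => ?_⟩
    · rw [← hg.1, show g (g⁻¹ v) = v from g.apply_symm_apply v]
    · rw [← hg.2.1, ← sym2_map_mul, mul_inv_cancel, sym2_map_one]
    · rw [← hg.2.2, ← image_map_mul, mul_inv_cancel, image_map_one]

/-- The group `G⁺(P)` of the proper isometries in `G(P)`. -/
def rotationGroup (P : GeometricPolyhedron) : Subgroup (E3 ≃ᵃⁱ[ℝ] E3) where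
  carrier := {g | g ∈ P.symmetryGroup ∧
    LinearMap.det (g.linearIsometryEquiv.toLinearEquiv : E3 →ₗ[ℝ] E3) = 1}
  one_mem' := ⟨one_mem _, LinearMap.det_id⟩
  mul_mem' {g h} hg hh := ⟨mul_mem hg.1 hh.1, by
    have := LinearMap.det_comp (g.linearIsometryEquiv.toLinearEquiv : E3 →ₗ[ℝ] E3)
      (h.linearIsometryEquiv.toLinearEquiv : E3 →ₗ[ℝ] E3)
    rw [hg.2, hh.2, mul_one] at this
    exact this⟩
  inv_mem' {g} hg := ⟨inv_mem hg.1, by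
    have := LinearEquiv.det_symm_mul_det g.linearIsometryEquiv.toLinearEquiv
    rw [hg.2, mul_one] at this
    exact this⟩

/-- A symmetry moves the proper elements of `P`. -/
noncomputable instance : MulAction P.symmetryGroup P.Cell where
  smul g
    | .vertex v => .vertex ⟨g.1 v, (g.2.1 v).2 v.2⟩
    | .edge e => .edge ⟨Sym2.map g.1 e, (g.2.2.1 e).2 e.2⟩
    | .face F => .face ⟨Sym2.map g.1 '' F, (g.2.2.2 F).2 F.2⟩
  one_smul c := by
    rcases c with v | e | F
    · rfl
    · exact congrArg Cell.edge (Subtype.ext (sym2_map_one _))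
    · exact congrArg Cell.face (Subtype.ext (image_map_one _))
  mul_smul g h c := by
    rcases c with v | e | F
    · rfl
    · exact congrArg Cell.edge (Subtype.ext (sym2_map_mul _ _ _))
    · exact congrArg Cell.face (Subtype.ext (image_map_mul _ _ _))

theorem Cell.smul_le_smul (g : P.symmetryGroup) {c d : P.Cell} (h : c ≤ d) : g • c ≤ g • d := by
  rcases c with v | e | F <;> rcases d with w | e' | F' <;> try exact h.elim
  · cases (show v = w from h); exact le_rfl
  · exact Sym2.mem_map.2 ⟨_, h, rfl⟩
  · obtain ⟨e, he, hv⟩ := (show ∃ e ∈ (F' : Set (Sym2 E3)), (v : E3) ∈ e from h)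
    exact ⟨_, Set.mem_image_of_mem _ he, Sym2.mem_map.2 ⟨_, hv, rfl⟩⟩
  · cases (show e = e' from h); exact le_rfl
  · exact Set.mem_image_of_mem _ h
  · cases (show F = F' from h); exact le_rfl

/-- The homomorphism `G(P) → Γ(P)` through which symmetries are viewed as automorphisms. -/
noncomputable def toAut (P : GeometricPolyhedron) : P.symmetryGroup →* P.AutGroup where
  toFun g :=
    { MulAction.toPerm g with
      map_rel_iff' := fun {c d} => ⟨fun h => by
        have := Cell.smul_le_smul g⁻¹ h
        simpa using this, fun h => Cell.smul_le_smul g h⟩ }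
  map_one' := RelIso.ext fun c => one_smul P.symmetryGroup c
  map_mul' g h := RelIso.ext fun c => mul_smul g h c

/-- A regular polyhedron of index 2: combinatorially regular, with `|Γ(P) : G(P)| = 2`. -/
def IsRegularOfIndexTwo (P : GeometricPolyhedron) : Prop :=
  P.IsCombRegular ∧ P.toAut.range.index = 2

/-- `O` is an orbit of `G(P)` on the vertices of `P`. -/
def IsVertexOrbit (P : GeometricPolyhedron) (O : Set E3) : Prop :=
  ∃ v ∈ P.verts, O = {w | ∃ g ∈ P.symmetryGroup, g v = w}

/-- `G⁺(P)` is simply transitive on the edges of `P`. -/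
def RotationsSimplyEdgeTransitive (P : GeometricPolyhedron) : Prop :=
  ∀ e ∈ P.edges, ∀ e' ∈ P.edges, ∃! g : E3 ≃ᵃⁱ[ℝ] E3, g ∈ P.rotationGroup ∧ Sym2.map g e = e'

end GeometricPolyhedron

/-- The five kinds of Platonic solids. -/
inductive PlatonicKind : Type
  | tetrahedron
  | cube
  | octahedron
  | icosahedron
  | dodecahedron

/-- The vertices of a standard model of each Platonic solid, with center `0`. -/
noncomputable def PlatonicKind.modelVerts : PlatonicKind → Set E3
  | .tetrahedron => {x | (∀ i, |x i| = 1) ∧ x 0 * x 1 * x 2 = 1}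
  | .cube => {x | ∀ i, |x i| = 1}
  | .octahedron => {x | ∃ i, |x i| = 1 ∧ x (i + 1) = 0 ∧ x (i + 2) = 0}
  | .icosahedron => {x | ∃ i, x i = 0 ∧ |x (i + 1)| = 1 ∧ |x (i + 2)| = Real.goldenRatio}
  | .dodecahedron => {x | (∀ i, |x i| = 1) ∨
      ∃ i, x i = 0 ∧ |x (i + 1)| = Real.goldenRatio⁻¹ ∧ |x (i + 2)| = Real.goldenRatio}

/-- A Platonic solid in Euclidean 3-space: the image of a standard model under a similarity
`x ↦ center + scale • iso x`. -/
structure PlatonicSolid where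
  kind : PlatonicKind
  center : E3
  scale : ℝ
  scale_pos : 0 < scale
  iso : E3 ≃ₗᵢ[ℝ] E3

/-- The graph on a point set whose edges join the pairs of distinct points at minimal distance.
For the vertex set of a Platonic solid this is the edge graph of the solid. -/
def minDistGraph (V : Set E3) : SimpleGraph E3 where
  Adj a b := a ∈ V ∧ b ∈ V ∧ a ≠ b ∧ ∀ c ∈ V, ∀ d ∈ V, c ≠ d → dist a b ≤ dist c d
  symm.symm a b h := ⟨h.2.1, h.1, h.2.2.1.symm, dist_comm a b ▸ h.2.2.2⟩
  loopless.irrefl _ h := h.2.2.1 rfl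

namespace PlatonicSolid

/-- The vertices of a Platonic solid. -/
noncomputable def verts (S : PlatonicSolid) : Set E3 :=
  (fun x => S.center + S.scale • S.iso x) '' S.kind.modelVerts

/-- The homothety `v ↦ v^◇` with the center of `S` and ratio `μ`. It takes `S` to a solid `S^◇`
aligned with `S` when `0 < μ`, and to one aligned with `-S` when `μ < 0`. -/
noncomputable def diamond (S : PlatonicSolid) (μ : ℝ) : E3 → E3 :=
  AffineMap.homothety S.center μ

/-- The combinatorial length of the segment from the vertex `v` of `S` to the vertex `w^◇` of
`S^◇`: if the two solids are aligned, the length of a shortest path from `v` to `w` along edges of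
`S`; if they are opposed tetrahedra, the length of a shortest path from `v` to the point `-w` (on the
ray of `w^◇`) along the edges of the cube whose vertices are those of `S` and `-S`. -/
noncomputable def combLength (S : PlatonicSolid) (μ : ℝ) (v w : E3) : ℕ :=
  if 0 < μ then (minDistGraph S.verts).dist v w
  else (minDistGraph (S.verts ∪ S.diamond (-1) '' S.verts)).dist v (S.diamond (-1) w)

end PlatonicSolid

/-- Every edge of `P` joins a vertex of `S` with a vertex of `S^◇` and has combinatorial length
`l`; that is, the edge length of `P` is `l`. -/
def GeometricPolyhedron.HasEdgeLength (P : GeometricPolyhedron) (S : PlatonicSolid) (μ : ℝ)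
    (l : ℕ) : Prop :=
  ∀ e ∈ P.edges, ∃ v ∈ S.verts, ∃ w ∈ S.verts, e = s(v, S.diamond μ w) ∧ S.combLength μ v w = l

/-! Write G for the symmetry group and Γ for the automorphism group. Some automorphism δ carries a
given vertex into the other orbit, so δ is not in G. If an automorphism γ fixing that vertex were
outside G too, then δγ would lie in G because the index is 2, although it also changes the orbit.
Hence vertex stabilizers in Γ come from G (`mem_range_toAut_of_fixes_vertex`), and the stabilizer in
G of a vertex is transitive on the flags there. With connectedness this makes every edge join the
two orbits, makes G transitive on edges, and gives each edge a nontrivial symmetry fixing it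
pointwise.

Symmetries permute the vertices of S and so fix its center. An edge therefore becomes a pair x, y of
vertices of the standard model, and the inner product of x and y is the same for all edges. The
cases x = y and x = -y are impossible, since the stabilizer of x would fix y and only one edge could
leave x (`ne_and_ne_neg_of_edge`). So x and y are independent, and the nontrivial symmetry fixing
the edge is the reflection in their plane. Composing with it turns improper symmetries into
rotations, which gives simple edge-transitivity.

The inner product determines the length of an edge, so excluding equal and opposite pairs leaves few
lengths. For the cube, a two-colouring by parity disconnects the edge graph (`kind_ne_cube`). For
the dodecahedron, at lengths 2 and 3 the reflection in the plane of x and y does not preserve the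
vertices (`dodecahedron_gram_ne`). Facts about the models are finite checks over ℤ[φ]. -/

/-! ### Edges and faces at a vertex, and connectedness. -/

namespace GeometricPolyhedron

variable {P : GeometricPolyhedron}

/-- Every vertex lies on an edge. -/
theorem exists_edge_of_mem_verts {v : E3} (hv : v ∈ P.verts) : ∃ e ∈ P.edges, v ∈ e := by
  obtain ⟨u, hu⟩ := (P.vertexFigure_connected v hv).nonempty
  exact ⟨_, hu, Sym2.mem_mk_right u v⟩

/-- Every edge lies on two different faces. -/
theorem exists_two_faces {e : Sym2 E3} (he : e ∈ P.edges) :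
    ∃ F ∈ P.faces, ∃ F' ∈ P.faces, e ∈ F ∧ e ∈ F' ∧ F ≠ F' := by
  obtain ⟨F, F', hne, h⟩ := Set.ncard_eq_two.1 (P.two_faces e he)
  have hF : F ∈ {F ∈ P.faces | e ∈ F} := by rw [h]; simp
  have hF' : F' ∈ {F ∈ P.faces | e ∈ F} := by rw [h]; simp
  exact ⟨F, hF.1, F', hF'.1, hF.2, hF'.2, hne⟩

end GeometricPolyhedron

/-- A polygon has a second edge at each vertex. -/
theorem IsPolygon.exists_other_edge {F : Set (Sym2 E3)} (hF : IsPolygon F) {e : Sym2 E3}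
    (he : e ∈ F) {v : E3} (hv : v ∈ e) : ∃ e' ∈ F, v ∈ e' ∧ e' ≠ e := by
  obtain ⟨n, hn, w, hw, rfl⟩ := hF
  obtain ⟨i, rfl⟩ := he
  -- Consecutive edges of the polygon could coincide only if 2 = 0 in `ZMod n`; this is where n ≥ 3
  -- enters.
  have h2 : (2 : ZMod n) ≠ 0 := by
    intro h
    have h' : ((2 : ℕ) : ZMod n) = 0 := by exact_mod_cast h
    have := Nat.le_of_dvd (by norm_num) ((ZMod.natCast_eq_zero_iff 2 n).1 h')
    omega
  rcases Sym2.mem_iff.1 hv with rfl | rfl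
  · refine ⟨s(w (i - 1), w (i - 1 + 1)), ⟨i - 1, rfl⟩, by simp, fun (h : _ = s(w i, w (i + 1))) => ?_⟩
    have h1 : w (i - 1) ∈ s(w i, w (i + 1)) := h ▸ Sym2.mem_mk_left _ _
    rcases Sym2.mem_iff.1 h1 with h1 | h1
    · have h3 := hw h1
      exact h2 (by linear_combination (-2 : ZMod n) * h3)
    · have h3 := hw h1
      exact h2 (by linear_combination -h3)
  · refine ⟨s(w (i + 1), w (i + 1 + 1)), ⟨i + 1, rfl⟩, by simp, fun (h : _ = s(w i, w (i + 1))) => ?_⟩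
    have h1 : w (i + 1 + 1) ∈ s(w i, w (i + 1)) := h ▸ Sym2.mem_mk_right _ _
    rcases Sym2.mem_iff.1 h1 with h1 | h1
    · have h3 := hw h1
      exact h2 (by linear_combination h3)
    · have h3 := hw h1
      exact h2 (by linear_combination 2 * h3)

namespace GeometricPolyhedron

variable {P : GeometricPolyhedron}

/-- Every vertex of an edge lies on a second edge. -/
theorem exists_other_edge {e : Sym2 E3} (he : e ∈ P.edges) {v : E3} (hv : v ∈ e) :
    ∃ e' ∈ P.edges, v ∈ e' ∧ e' ≠ e := by
  obtain ⟨F, hF, -, -, heF, -⟩ := exists_two_faces he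
  obtain ⟨e', he', h⟩ := (P.face_polygon F hF).exists_other_edge heF hv
  exact ⟨e', P.face_edges F hF he', h⟩

/-- A set of points closed under adjacency that contains a vertex contains all vertices. -/
theorem verts_subset_of_closed {A : Set E3} (hA : ∀ a b, s(a, b) ∈ P.edges → a ∈ A → b ∈ A)
    {a : E3} (ha : a ∈ P.verts) (haA : a ∈ A) : P.verts ⊆ A := by
  intro b hb
  obtain ⟨p⟩ := P.connected.preconnected ⟨a, ha⟩ ⟨b, hb⟩
  have : ∀ (x y : P.verts) (_ : (segmentGraph P.verts P.edges).Walk x y),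
      (x : E3) ∈ A → (y : E3) ∈ A := by
    intro x y p
    induction p with
    | nil => exact id
    | cons h _ ih => exact fun hx => ih (hA _ _ h.2 hx)
  exact this _ _ p haA

/-! ### Vertex orbits and the consequences of index 2. -/

namespace IsVertexOrbit

variable {O O' : Set E3}

theorem subset_verts (hO : P.IsVertexOrbit O) : O ⊆ P.verts := by
  obtain ⟨v, hv, rfl⟩ := hO
  rintro _ ⟨g, hg, rfl⟩
  exact (hg.1 v).2 hv

theorem map_mem (hO : P.IsVertexOrbit O) {g : E3 ≃ᵃⁱ[ℝ] E3} (hg : g ∈ P.symmetryGroup) {v : E3}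
    (hv : v ∈ O) : g v ∈ O := by
  obtain ⟨u, -, rfl⟩ := hO
  obtain ⟨h, hh, rfl⟩ := hv
  exact ⟨g * h, mul_mem hg hh, rfl⟩

theorem exists_map_eq (hO : P.IsVertexOrbit O) {v w : E3} (hv : v ∈ O) (hw : w ∈ O) :
    ∃ g ∈ P.symmetryGroup, g v = w := by
  obtain ⟨u, -, rfl⟩ := hO
  obtain ⟨g, hg, rfl⟩ := hv
  obtain ⟨h, hh, rfl⟩ := hw
  exact ⟨h * g⁻¹, mul_mem hh (inv_mem hg), congrArg h (g.symm_apply_apply u)⟩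

theorem disjoint (hO : P.IsVertexOrbit O) (hO' : P.IsVertexOrbit O') (hne : O ≠ O') :
    Disjoint O O' := by
  refine Set.disjoint_left.2 fun a ha ha' => hne (Set.Subset.antisymm ?_ ?_)
  · intro b hb
    obtain ⟨g, hg, rfl⟩ := hO.exists_map_eq ha hb
    exact hO'.map_mem hg ha'
  · intro b hb
    obtain ⟨g, hg, rfl⟩ := hO'.exists_map_eq ha' hb
    exact hO.map_mem hg ha

end IsVertexOrbit

/-- In a regular polyhedron of index 2 whose vertices form more than one orbit, the automorphisms
that fix a vertex come from symmetries. -/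
theorem mem_range_toAut_of_fixes_vertex (hP : P.IsRegularOfIndexTwo) {v : P.verts}
    (hv : ∃ u ∈ P.verts, ∀ g ∈ P.symmetryGroup, g (v : E3) ≠ u) {γ : P.AutGroup}
    (hγ : γ (.vertex v) = .vertex v) : γ ∈ P.toAut.range := by
  by_contra hγG
  obtain ⟨u, hu, huv⟩ := hv
  have flag : ∀ w : P.verts, ∃ Φ : P.FlagOf, Φ.v = w := by
    intro w
    obtain ⟨e, he, hw⟩ := exists_edge_of_mem_verts w.2
    obtain ⟨F, hF, -, -, heF, -⟩ := exists_two_faces he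
    exact ⟨⟨w, ⟨e, he⟩, ⟨F, hF⟩, hw, heF⟩, rfl⟩
  obtain ⟨Φ, rfl⟩ := flag v
  obtain ⟨Ψ, hΨ⟩ := flag ⟨u, hu⟩
  obtain ⟨δ, hδ, -⟩ := hP.1 Φ Ψ
  have key : ∀ ε : P.AutGroup, ε ∈ P.toAut.range → ε (.vertex Φ.v) ≠ .vertex Ψ.v := by
    rintro _ ⟨g, rfl⟩ h
    refine huv g.1 g.2 ?_
    have h' := congrArg Subtype.val (Cell.vertex.inj h)
    rw [hΨ] at h'
    exact h'
  -- Either δ itself, or δγ as a product of two elements outside a subgroup of index 2, comes from a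
  -- symmetry; both send the vertex into the other orbit.
  by_cases hδG : δ ∈ P.toAut.range
  · exact key δ hδG hδ
  · refine key (δ * γ) ((Subgroup.mul_mem_iff_of_index_two hP.2).2 (iff_of_false hδG hγG)) ?_
    rw [RelIso.coe_mul, Function.comp_apply, hγ, hδ]

/-! ### Transitivity of the symmetry group on flags at a vertex and on edges. -/

section TwoOrbits

variable {O O' : Set E3} (hP : P.IsRegularOfIndexTwo) (hO : P.IsVertexOrbit O)
  (hO' : P.IsVertexOrbit O') (hne : O ≠ O') (hV : P.verts = O ∪ O')

include hP hO hO' hne hV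

/-- The stabilizer of a vertex in the symmetry group is transitive on the flags at that vertex. -/
theorem exists_symmetry_map_flag {v : E3} {e e' : Sym2 E3} {F F' : Set (Sym2 E3)}
    (he : e ∈ P.edges) (he' : e' ∈ P.edges) (hF : F ∈ P.faces) (hF' : F' ∈ P.faces)
    (hve : v ∈ e) (hve' : v ∈ e') (heF : e ∈ F) (heF' : e' ∈ F') :
    ∃ g ∈ P.symmetryGroup, g v = v ∧ Sym2.map g e = e' ∧ Sym2.map g '' F = F' := by
  have hv := P.edge_verts e he v hve
  have hd := hO.disjoint hO' hne
  have hex : ∃ u ∈ P.verts, ∀ g ∈ P.symmetryGroup, g v ≠ u := by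
    rw [hV] at hv
    rcases hv with hv | hv
    · obtain ⟨u, hu, h⟩ := hO'
      refine ⟨u, hu, fun g hg hgv => Set.disjoint_left.1 hd (hO.map_mem hg hv) ?_⟩
      rw [hgv, h]
      exact ⟨1, one_mem _, rfl⟩
    · obtain ⟨u, hu, h⟩ := hO
      refine ⟨u, hu, fun g hg hgv => Set.disjoint_right.1 hd (hO'.map_mem hg hv) ?_⟩
      rw [hgv, h]
      exact ⟨1, one_mem _, rfl⟩
  let Φ : P.FlagOf := ⟨⟨v, hv⟩, ⟨e, he⟩, ⟨F, hF⟩, hve, heF⟩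
  let Ψ : P.FlagOf := ⟨⟨v, hv⟩, ⟨e', he'⟩, ⟨F', hF'⟩, hve', heF'⟩
  obtain ⟨γ, hγv, hγe, hγF⟩ := hP.1 Φ Ψ
  obtain ⟨g, rfl⟩ := mem_range_toAut_of_fixes_vertex hP (v := ⟨v, hv⟩) hex hγv
  exact ⟨g.1, g.2, congrArg Subtype.val (Cell.vertex.inj hγv),
    congrArg Subtype.val (Cell.edge.inj hγe), congrArg Subtype.val (Cell.face.inj hγF)⟩

theorem exists_symmetry_map_edge_at {v : E3} {e e' : Sym2 E3} (he : e ∈ P.edges)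
    (he' : e' ∈ P.edges) (hve : v ∈ e) (hve' : v ∈ e') :
    ∃ g ∈ P.symmetryGroup, g v = v ∧ Sym2.map g e = e' := by
  obtain ⟨F, hF, -, -, heF, -⟩ := exists_two_faces he
  obtain ⟨F', hF', -, -, heF', -⟩ := exists_two_faces he'
  obtain ⟨g, hg, hv, h, -⟩ :=
    exists_symmetry_map_flag hP hO hO' hne hV he he' hF hF' hve hve' heF heF'
  exact ⟨g, hg, hv, h⟩

/-- Every edge is fixed pointwise by a nontrivial symmetry. -/
theorem exists_ne_one_fixes_edge {a b : E3} (he : s(a, b) ∈ P.edges) :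
    ∃ g ∈ P.symmetryGroup, g a = a ∧ g b = b ∧ g ≠ 1 := by
  obtain ⟨F, hF, F', hF', heF, heF', hFF⟩ := exists_two_faces he
  -- The two flags share the vertex and the edge and differ in the face, so the symmetry between
  -- them is not the identity.
  obtain ⟨g, hg, ha, h, hgF⟩ := exists_symmetry_map_flag hP hO hO' hne hV he he hF hF'
    (Sym2.mem_mk_left a b) (Sym2.mem_mk_left a b) heF heF'
  refine ⟨g, hg, ha, ?_, ?_⟩
  · rw [Sym2.map_mk, ha] at h
    exact Sym2.congr_right.1 h
  · rintro rfl
    exact hFF ((image_map_one F).symm.trans hgF)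

/-- The edges join vertices of different orbits. -/
theorem mem_right_orbit_of_edge {a b : E3} (he : s(a, b) ∈ P.edges) (ha : a ∈ O) : b ∈ O' := by
  by_contra hb
  have hbO : b ∈ O := by
    have := P.edge_verts _ he b (Sym2.mem_mk_right a b)
    rw [hV] at this
    exact this.resolve_right hb
  -- A single edge inside `O` can be moved to any vertex of `O` and then to any edge there, so no
  -- edge would leave `O`, against connectedness.
  have closed : ∀ x y, s(x, y) ∈ P.edges → x ∈ O → y ∈ O := by
    intro x y hxy hx
    obtain ⟨g, hg, rfl⟩ := hO.exists_map_eq ha hx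
    obtain ⟨h, hh, hgx, hhe⟩ := exists_symmetry_map_edge_at hP hO hO' hne hV
      ((hg.2.1 _).2 he) hxy (Sym2.mem_map.2 ⟨a, Sym2.mem_mk_left a b, rfl⟩)
      (Sym2.mem_mk_left _ _)
    rw [Sym2.map_mk, Sym2.map_mk, hgx] at hhe
    rw [← Sym2.congr_right.1 hhe]
    exact hO.map_mem hh (hO.map_mem hg hbO)
  obtain ⟨u, hu, h⟩ := hO'
  have huO := verts_subset_of_closed closed (hO.subset_verts ha) ha hu
  refine Set.disjoint_left.1 (hO.disjoint ⟨u, hu, h⟩ hne) huO ?_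
  rw [h]
  exact ⟨1, one_mem _, rfl⟩

/-- Every edge has exactly one endpoint in each orbit. -/
theorem exists_eq_mk_of_mem_edges {e : Sym2 E3} (he : e ∈ P.edges) :
    ∃ a ∈ O, ∃ b ∈ O', e = s(a, b) := by
  induction e with
  | h a b =>
    have ha := P.edge_verts _ he a (Sym2.mem_mk_left a b)
    rw [hV] at ha
    rcases ha with ha | ha
    · exact ⟨a, ha, b, mem_right_orbit_of_edge hP hO hO' hne hV he ha, rfl⟩
    · exact ⟨b, mem_right_orbit_of_edge hP hO' hO hne.symm (hV.trans (Set.union_comm _ _)) he ha,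
        a, ha, Sym2.eq_swap⟩

/-- The symmetry group is transitive on the edges. -/
theorem exists_symmetry_map_edge {a b a' b' : E3} (he : s(a, b) ∈ P.edges)
    (he' : s(a', b') ∈ P.edges) (ha : a ∈ O) (ha' : a' ∈ O) :
    ∃ g ∈ P.symmetryGroup, g a = a' ∧ g b = b' := by
  obtain ⟨g, hg, rfl⟩ := hO.exists_map_eq ha ha'
  obtain ⟨h, hh, hgx, hhe⟩ := exists_symmetry_map_edge_at hP hO hO' hne hV
    ((hg.2.1 _).2 he) he' (Sym2.mem_map.2 ⟨a, Sym2.mem_mk_left a b, rfl⟩)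
    (Sym2.mem_mk_left _ _)
  rw [Sym2.map_mk, Sym2.map_mk, hgx] at hhe
  exact ⟨h * g, mul_mem hh hg, hgx, Sym2.congr_right.1 hhe⟩

end TwoOrbits

end GeometricPolyhedron

/-! ### Exact arithmetic in ℤ[φ]. -/

/-- The ring `ℤ[φ]`. -/
abbrev GoldenInt : Type := QuadraticAlgebra ℤ 1 1

/-- The embedding `ℤ[φ] → ℝ`. -/
noncomputable def GoldenInt.toReal : GoldenInt →ₐ[ℤ] ℝ :=
  QuadraticAlgebra.lift ⟨Real.goldenRatio, by
    have := Real.goldenRatio_sq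
    simp only [one_smul]
    linarith⟩

theorem GoldenInt.toReal_apply (z : GoldenInt) :
    GoldenInt.toReal z = z.re + z.im * Real.goldenRatio := by
  simp [GoldenInt.toReal, QuadraticAlgebra.lift]

/-- Rests on the irrationality of φ. Equalities between real inner products can thereby be decided
in ℤ[φ]. -/
theorem GoldenInt.toReal_injective : Function.Injective GoldenInt.toReal := by
  rw [injective_iff_map_eq_zero]
  intro z hz
  rw [GoldenInt.toReal_apply] at hz
  by_cases h : z.im = 0
  · rw [h] at hz
    ext
    · simpa using hz
    · simpa using h
  · exfalso
    have h1 : Irrational (z.re + z.im * Real.goldenRatio) :=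
      (Real.goldenRatio_irrational.intCast_mul h).intCast_add z.re
    rw [hz] at h1
    simp at h1

/-- A sufficient criterion in integers, obtained from the bound φ > 3/2. -/
theorem GoldenInt.toReal_pos {z : GoldenInt} (h : 0 < 2 * z.re + 3 * z.im) (h' : 0 ≤ z.im) :
    0 < GoldenInt.toReal z := by
  rw [GoldenInt.toReal_apply]
  have h3 : (3 / 2 : ℝ) < Real.goldenRatio := by
    have := Real.goldenRatio_sq
    have := Real.goldenRatio_pos
    nlinarith
  have h1 : (0 : ℝ) < 2 * z.re + 3 * z.im := by exact_mod_cast h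
  have h2 : (0 : ℝ) ≤ z.im := by exact_mod_cast h'
  nlinarith [mul_nonneg h2 (sub_nonneg.2 h3.le)]

/-- Triples of elements of `ℤ[φ]`. -/
abbrev GoldenVec : Type := GoldenInt × GoldenInt × GoldenInt

namespace GoldenVec

/-- The standard bilinear form. -/
def gram (x y : GoldenVec) : GoldenInt := x.1 * y.1 + x.2.1 * y.2.1 + x.2.2 * y.2.2

/-- The cross product. -/
def cross (x y : GoldenVec) : GoldenVec :=
  (x.2.1 * y.2.2 - x.2.2 * y.2.1, x.2.2 * y.1 - x.1 * y.2.2, x.1 * y.2.1 - x.2.1 * y.1)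

/-- The embedding into Euclidean space. -/
noncomputable def toE3 (x : GoldenVec) : E3 :=
  !₂[GoldenInt.toReal x.1, GoldenInt.toReal x.2.1, GoldenInt.toReal x.2.2]

theorem inner_toE3 (x y : GoldenVec) :
    inner ℝ x.toE3 y.toE3 = GoldenInt.toReal (gram x y) := by
  simp [toE3, gram, PiLp.inner_apply, Fin.sum_univ_three, mul_comm]

theorem toE3_injective : Function.Injective toE3 := by
  intro x y h
  have h0 := congrArg (fun u : E3 => u 0) h
  have h1 := congrArg (fun u : E3 => u 1) h
  have h2 := congrArg (fun u : E3 => u 2) h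
  simp only [toE3] at h0 h1 h2
  exact Prod.ext (GoldenInt.toReal_injective (by simpa using h0))
    (Prod.ext (GoldenInt.toReal_injective (by simpa using h1))
      (GoldenInt.toReal_injective (by simpa using h2)))

theorem toE3_neg (x : GoldenVec) : (-x).toE3 = -x.toE3 := by
  ext i; fin_cases i <;> simp [toE3]

theorem toE3_zero : (0 : GoldenVec).toE3 = 0 := by
  ext i; fin_cases i <;> simp [toE3]

theorem toE3_add (x y : GoldenVec) : (x + y).toE3 = x.toE3 + y.toE3 := by
  ext i; fin_cases i <;> simp [toE3]

end GoldenVec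

/-! ### Integral models of the solids and finite checks on them. -/

namespace PlatonicKind

/-- The two signs. -/
def signs : List GoldenInt := [1, -1]

/-- The vertices of the standard models as triples over `ℤ[φ]`. -/
def vecs : PlatonicKind → List GoldenVec
  | .tetrahedron => [(1, 1, 1), (1, -1, -1), (-1, 1, -1), (-1, -1, 1)]
  | .cube => signs.flatMap fun a => signs.flatMap fun b => signs.map fun c => (a, b, c)
  | .octahedron => signs.flatMap fun a => [(a, 0, 0), (0, a, 0), (0, 0, a)]
  | .icosahedron => signs.flatMap fun a => signs.flatMap fun b =>
      [(0, a, ⟨0, 1⟩ * b), (⟨0, 1⟩ * b, 0, a), (a, ⟨0, 1⟩ * b, 0)]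
  | .dodecahedron =>
      (signs.flatMap fun a => signs.flatMap fun b => signs.map fun c => (a, b, c)) ++
      signs.flatMap fun a => signs.flatMap fun b =>
        -- `⟨-1, 1⟩` is φ - 1 = φ⁻¹.
        [(0, ⟨-1, 1⟩ * a, ⟨0, 1⟩ * b), (⟨0, 1⟩ * b, 0, ⟨-1, 1⟩ * a),
          (⟨-1, 1⟩ * a, ⟨0, 1⟩ * b, 0)]

/-- The distance in the edge graph of two vertices of the standard model, as a function of their
inner product. -/
def level : PlatonicKind → GoldenInt → ℕ
  | .tetrahedron, z => if z = ⟨3, 0⟩ then 0 else 1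
  | .cube, z => if z = ⟨3, 0⟩ then 0 else if z = ⟨1, 0⟩ then 1 else if z = ⟨-1, 0⟩ then 2 else 3
  | .octahedron, z => if z = ⟨1, 0⟩ then 0 else if z = ⟨0, 0⟩ then 1 else 2
  | .icosahedron, z =>
      if z = ⟨2, 1⟩ then 0 else if z = ⟨0, 1⟩ then 1 else if z = ⟨0, -1⟩ then 2 else 3
  | .dodecahedron, z =>
      if z = ⟨3, 0⟩ then 0 else if z = ⟨-1, 2⟩ then 1 else if z = ⟨1, 0⟩ then 2
      else if z = ⟨-1, 0⟩ then 3 else if z = ⟨1, -2⟩ then 4 else 5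

/-- The inner product of adjacent vertices of the standard model. -/
def adjGram : PlatonicKind → GoldenInt
  | .tetrahedron => ⟨-1, 0⟩
  | .cube => ⟨1, 0⟩
  | .octahedron => ⟨0, 0⟩
  | .icosahedron => ⟨0, 1⟩
  | .dodecahedron => ⟨-1, 2⟩

/-- The squared circumradius of the standard model. -/
def sqRadius : PlatonicKind → GoldenInt
  | .tetrahedron => ⟨3, 0⟩
  | .cube => ⟨3, 0⟩
  | .octahedron => ⟨1, 0⟩
  | .icosahedron => ⟨2, 1⟩
  | .dodecahedron => ⟨3, 0⟩

open GoldenVec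

theorem gram_self (k : PlatonicKind) : ∀ x ∈ k.vecs, gram x x = k.sqRadius := by
  cases k <;> decide +kernel

theorem level_sqRadius (k : PlatonicKind) : k.level k.sqRadius = 0 := by
  cases k <;> decide +kernel

theorem eq_of_level_eq_zero (k : PlatonicKind) :
    ∀ x ∈ k.vecs, ∀ y ∈ k.vecs, k.level (gram x y) = 0 → x = y := by
  cases k <;> decide +kernel

/-- One step along an edge lowers the level by at most 1, so no walk is shorter than the level. -/
theorem level_le_level_add_one (k : PlatonicKind) :
    ∀ x ∈ k.vecs, ∀ y ∈ k.vecs, k.level (gram x y) = 1 → ∀ z ∈ k.vecs,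
      k.level (gram x z) ≤ k.level (gram y z) + 1 := by
  cases k <;> decide +kernel

/-- Allows greedy descent to the target, which produces a walk as long as the level. -/
theorem exists_level_add_one (k : PlatonicKind) :
    ∀ x ∈ k.vecs, ∀ z ∈ k.vecs, x ≠ z → ∃ y ∈ k.vecs,
      k.level (gram x y) = 1 ∧ k.level (gram y z) + 1 = k.level (gram x z) := by
  cases k <;> decide +kernel

/-- Adjacent vertices have the largest inner product among distinct ones; strictness is stated in
the form that `GoldenInt.toReal_pos` accepts. -/
theorem level_eq_one_or (k : PlatonicKind) :
    ∀ x ∈ k.vecs, ∀ y ∈ k.vecs, x = y ∨ k.level (gram x y) = 1 ∧ gram x y = k.adjGram ∨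
      k.level (gram x y) ≠ 1 ∧ 0 < 2 * (k.adjGram - gram x y).re + 3 * (k.adjGram - gram x y).im ∧
        0 ≤ (k.adjGram - gram x y).im := by
  cases k <;> decide +kernel

/-- Makes the center of a solid the centroid of its vertices, hence a fixed point of every symmetry.
-/
theorem sum_vecs (k : PlatonicKind) : k.vecs.sum = 0 := by
  cases k <;> decide +kernel

theorem nodup_vecs (k : PlatonicKind) : k.vecs.Nodup := by
  cases k <;> decide +kernel

theorem exists_adj_vecs (k : PlatonicKind) :
    ∃ x ∈ k.vecs, ∃ y ∈ k.vecs, k.level (gram x y) = 1 := by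
  cases k <;> decide +kernel

/-- The vertex `u` lies off the plane of `x` and `y`, and its mirror image in that plane, having the
same inner products with `x` and `y`, is not a vertex. -/
theorem dodecahedron_exists_rigid :
    ∀ x ∈ vecs .dodecahedron, ∀ y ∈ vecs .dodecahedron, gram x y = 1 ∨ gram x y = -1 →
      ∃ u ∈ vecs .dodecahedron, gram u (cross x y) ≠ 0 ∧ ∀ u' ∈ vecs .dodecahedron,
        gram u' x = gram u x → gram u' y = gram u y → u' = u := by
  decide +kernel

end PlatonicKind

/-! ### Agreement of the integral models with the real ones. -/

theorem GoldenVec.toE3_eq_iff (x : GoldenVec) (u : E3) :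
    x.toE3 = u ↔ u 0 = GoldenInt.toReal x.1 ∧ u 1 = GoldenInt.toReal x.2.1 ∧
      u 2 = GoldenInt.toReal x.2.2 := by
  constructor
  · rintro rfl; simp [toE3]
  · rintro ⟨h0, h1, h2⟩
    ext i; fin_cases i <;> simp [toE3, h0, h1, h2]

namespace PlatonicKind

theorem exists_sign_of_abs_eq {t : ℝ} {z : GoldenInt} (h : |t| = GoldenInt.toReal z) :
    ∃ a ∈ signs, t = GoldenInt.toReal (z * a) := by
  rcases eq_or_eq_neg_of_abs_eq h with h | h
  · exact ⟨1, by simp [signs], by simp [h]⟩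
  · exact ⟨-1, by simp [signs], by simp [h]⟩

theorem exists_sign_of_abs_eq_one {t : ℝ} (h : |t| = 1) :
    ∃ a ∈ signs, t = GoldenInt.toReal a := by
  simpa using exists_sign_of_abs_eq (z := 1) (by simpa using h)

theorem abs_toReal_sign {a : GoldenInt} (ha : a ∈ signs) : |GoldenInt.toReal a| = 1 := by
  simp only [signs, List.mem_cons, List.not_mem_nil, or_false] at ha
  rcases ha with rfl | rfl <;> simp

theorem toReal_phi : GoldenInt.toReal ⟨0, 1⟩ = Real.goldenRatio := by
  simp [GoldenInt.toReal_apply]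

theorem toReal_phi_inv : GoldenInt.toReal ⟨-1, 1⟩ = Real.goldenRatio⁻¹ := by
  rw [GoldenInt.toReal_apply, Real.inv_goldenRatio, ← Real.one_sub_goldenRatio]
  push_cast
  ring

theorem toE3_mem_modelVerts (k : PlatonicKind) {x : GoldenVec} (hx : x ∈ k.vecs) :
    x.toE3 ∈ k.modelVerts := by
  have hφ := abs_of_pos Real.goldenRatio_pos
  cases k
  · simp only [vecs, List.mem_cons, List.not_mem_nil, or_false] at hx
    rcases hx with rfl | rfl | rfl | rfl <;>
      simp [modelVerts, GoldenVec.toE3, Fin.forall_fin_succ]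
  · simp only [vecs, List.mem_flatMap, List.mem_map] at hx
    obtain ⟨a, ha, b, hb, c, hc, rfl⟩ := hx
    simp [modelVerts, GoldenVec.toE3, Fin.forall_fin_succ, abs_toReal_sign, *]
  · simp only [vecs, List.mem_flatMap, List.mem_cons, List.not_mem_nil, or_false] at hx
    obtain ⟨a, ha, rfl | rfl | rfl⟩ := hx <;>
      simp [modelVerts, GoldenVec.toE3, Fin.exists_fin_succ, abs_toReal_sign, *]
  · simp only [vecs, List.mem_flatMap, List.mem_cons, List.not_mem_nil, or_false] at hx
    obtain ⟨a, ha, b, hb, rfl | rfl | rfl⟩ := hx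
    · exact ⟨0, by simp [GoldenVec.toE3, abs_toReal_sign, toReal_phi, abs_mul, *]⟩
    · exact ⟨1, by simp [GoldenVec.toE3, abs_toReal_sign, toReal_phi, abs_mul, *]⟩
    · exact ⟨2, by simp [GoldenVec.toE3, abs_toReal_sign, toReal_phi, abs_mul, *]⟩
  · simp only [vecs, List.mem_append, List.mem_flatMap, List.mem_map, List.mem_cons,
      List.not_mem_nil, or_false] at hx
    rcases hx with ⟨a, ha, b, hb, c, hc, rfl⟩ | ⟨a, ha, b, hb, rfl | rfl | rfl⟩
    · exact Or.inl (by simp [GoldenVec.toE3, Fin.forall_fin_succ, abs_toReal_sign, *])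
    · exact Or.inr ⟨0, by
        simp [GoldenVec.toE3, abs_toReal_sign, toReal_phi, toReal_phi_inv, abs_mul, *]
        positivity⟩
    · exact Or.inr ⟨1, by
        simp [GoldenVec.toE3, abs_toReal_sign, toReal_phi, toReal_phi_inv, abs_mul, *]
        positivity⟩
    · exact Or.inr ⟨2, by
        simp [GoldenVec.toE3, abs_toReal_sign, toReal_phi, toReal_phi_inv, abs_mul, *]
        positivity⟩

theorem exists_toE3_eq_of_mem_modelVerts (k : PlatonicKind) {u : E3} (hu : u ∈ k.modelVerts) :
    ∃ x ∈ k.vecs, x.toE3 = u := by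
  cases k
  · obtain ⟨h, hp⟩ := hu
    obtain ⟨a, ha, h0⟩ := exists_sign_of_abs_eq_one (h 0)
    obtain ⟨b, hb, h1⟩ := exists_sign_of_abs_eq_one (h 1)
    obtain ⟨c, hc, h2⟩ := exists_sign_of_abs_eq_one (h 2)
    refine ⟨(a, b, c), ?_, (GoldenVec.toE3_eq_iff _ _).2 ⟨h0, h1, h2⟩⟩
    rw [h0, h1, h2, ← map_mul, ← map_mul, ← map_one GoldenInt.toReal] at hp
    have hp := GoldenInt.toReal_injective hp
    clear h0 h1 h2 h
    have key : ∀ a ∈ signs, ∀ b ∈ signs, ∀ c ∈ signs, a * b * c = 1 →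
        (a, b, c) ∈ vecs .tetrahedron := by decide +kernel
    exact key a ha b hb c hc hp
  · obtain ⟨a, ha, h0⟩ := exists_sign_of_abs_eq_one (hu 0)
    obtain ⟨b, hb, h1⟩ := exists_sign_of_abs_eq_one (hu 1)
    obtain ⟨c, hc, h2⟩ := exists_sign_of_abs_eq_one (hu 2)
    refine ⟨(a, b, c), ?_, (GoldenVec.toE3_eq_iff _ _).2 ⟨h0, h1, h2⟩⟩
    simp only [vecs, List.mem_flatMap, List.mem_map]
    exact ⟨a, ha, b, hb, c, hc, rfl⟩
  · obtain ⟨i, h, h', h''⟩ := hu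
    obtain ⟨a, ha, h⟩ := exists_sign_of_abs_eq_one h
    simp only [vecs, List.mem_flatMap]
    fin_cases i
    · exact ⟨_, ⟨a, ha, .head _⟩, (GoldenVec.toE3_eq_iff _ _).2 ⟨h, by simpa using h',
        by simpa using h''⟩⟩
    · exact ⟨_, ⟨a, ha, .tail _ (.head _)⟩, (GoldenVec.toE3_eq_iff _ _).2 ⟨by simpa using h'', h,
        by simpa using h'⟩⟩
    · exact ⟨_, ⟨a, ha, .tail _ (.tail _ (.head _))⟩, (GoldenVec.toE3_eq_iff _ _).2
        ⟨by simpa using h', by simpa using h'', h⟩⟩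
  · obtain ⟨i, h, h', h''⟩ := hu
    obtain ⟨a, ha, h'⟩ := exists_sign_of_abs_eq_one h'
    obtain ⟨b, hb, h''⟩ := exists_sign_of_abs_eq (h''.trans toReal_phi.symm)
    simp only [vecs, List.mem_flatMap]
    fin_cases i
    · exact ⟨_, ⟨a, ha, b, hb, .head _⟩, (GoldenVec.toE3_eq_iff _ _).2 ⟨by simpa using h,
        h', h''⟩⟩
    · exact ⟨_, ⟨a, ha, b, hb, .tail _ (.head _)⟩, (GoldenVec.toE3_eq_iff _ _).2 ⟨h'',
        by simpa using h, h'⟩⟩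
    · exact ⟨_, ⟨a, ha, b, hb, .tail _ (.tail _ (.head _))⟩, (GoldenVec.toE3_eq_iff _ _).2
        ⟨h', h'', by simpa using h⟩⟩
  · simp only [vecs, List.mem_append, List.mem_flatMap, List.mem_map]
    rcases hu with hu | ⟨i, h, h', h''⟩
    · obtain ⟨a, ha, h0⟩ := exists_sign_of_abs_eq_one (hu 0)
      obtain ⟨b, hb, h1⟩ := exists_sign_of_abs_eq_one (hu 1)
      obtain ⟨c, hc, h2⟩ := exists_sign_of_abs_eq_one (hu 2)
      exact ⟨(a, b, c), Or.inl ⟨a, ha, b, hb, c, hc, rfl⟩,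
        (GoldenVec.toE3_eq_iff _ _).2 ⟨h0, h1, h2⟩⟩
    · obtain ⟨a, ha, h'⟩ := exists_sign_of_abs_eq (h'.trans toReal_phi_inv.symm)
      obtain ⟨b, hb, h''⟩ := exists_sign_of_abs_eq (h''.trans toReal_phi.symm)
      fin_cases i
      · exact ⟨_, Or.inr ⟨a, ha, b, hb, .head _⟩, (GoldenVec.toE3_eq_iff _ _).2
          ⟨by simpa using h, h', h''⟩⟩
      · exact ⟨_, Or.inr ⟨a, ha, b, hb, .tail _ (.head _)⟩, (GoldenVec.toE3_eq_iff _ _).2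
          ⟨h'', by simpa using h, h'⟩⟩
      · exact ⟨_, Or.inr ⟨a, ha, b, hb, .tail _ (.tail _ (.head _))⟩,
          (GoldenVec.toE3_eq_iff _ _).2 ⟨h', h'', by simpa using h⟩⟩

theorem modelVerts_eq (k : PlatonicKind) :
    k.modelVerts = GoldenVec.toE3 '' {x | x ∈ k.vecs} :=
  Set.Subset.antisymm (fun _ hu => k.exists_toE3_eq_of_mem_modelVerts hu)
    (Set.image_subset_iff.2 fun _ hx => k.toE3_mem_modelVerts hx)

end PlatonicKind

/-! ### Linear isometries fixing two independent vectors. -/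

/-- The cross product of vectors of Euclidean 3-space. -/
noncomputable def E3.cross (a b : E3) : E3 :=
  !₂[a 1 * b 2 - a 2 * b 1, a 2 * b 0 - a 0 * b 2, a 0 * b 1 - a 1 * b 0]

theorem E3.inner_eq (a b : E3) : inner ℝ a b = a 0 * b 0 + a 1 * b 1 + a 2 * b 2 := by
  simp [PiLp.inner_apply, Fin.sum_univ_three, mul_comm]

theorem E3.inner_cross_left (a b : E3) : inner ℝ a (E3.cross a b) = 0 := by
  rw [E3.inner_eq]; simp [E3.cross]; ring

theorem E3.inner_cross_right (a b : E3) : inner ℝ b (E3.cross a b) = 0 := by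
  rw [E3.inner_eq]; simp [E3.cross]; ring

/-- A vector orthogonal to `a` and `b` is parallel to their cross product. -/
theorem E3.inner_self_smul_of_orthogonal {a b u : E3} (ha : inner ℝ a u = 0)
    (hb : inner ℝ b u = 0) :
    inner ℝ (E3.cross a b) (E3.cross a b) • u = inner ℝ (E3.cross a b) u • E3.cross a b := by
  rw [E3.inner_eq] at ha hb
  -- With n = a × b, these are the components of n × u = (a·u) b - (b·u) a = 0.
  have h0 : (E3.cross a b) 1 * u 2 - (E3.cross a b) 2 * u 1 = 0 := by
    simp [E3.cross]
    linear_combination b 0 * ha - a 0 * hb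
  have h1 : (E3.cross a b) 2 * u 0 - (E3.cross a b) 0 * u 2 = 0 := by
    simp [E3.cross]
    linear_combination b 1 * ha - a 1 * hb
  have h2 : (E3.cross a b) 0 * u 1 - (E3.cross a b) 1 * u 0 = 0 := by
    simp [E3.cross]
    linear_combination b 2 * ha - a 2 * hb
  generalize E3.cross a b = n at *
  rw [E3.inner_eq, E3.inner_eq]
  ext i
  fin_cases i <;> simp
  · linear_combination n 2 * h1 - n 1 * h2
  · linear_combination n 0 * h2 - n 2 * h0
  · linear_combination n 1 * h0 - n 0 * h1

/-- A linear isometry of Euclidean 3-space fixing two independent vectors is determined by its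
eigenvalue on their cross product. -/
theorem LinearIsometryEquiv.map_cross_of_fixes (M : E3 ≃ₗᵢ[ℝ] E3) {a b : E3} (ha : M a = a)
    (hb : M b = b) (hn : E3.cross a b ≠ 0) :
    M (E3.cross a b) = LinearMap.det (M.toLinearEquiv : E3 →ₗ[ℝ] E3) • E3.cross a b ∧
      (LinearMap.det (M.toLinearEquiv : E3 →ₗ[ℝ] E3) = 1 → M = 1) := by
  have hk := E3.inner_self_smul_of_orthogonal (a := a) (b := b) (u := M (E3.cross a b))
    (by simpa only [ha, E3.inner_cross_left] using M.inner_map_map a (E3.cross a b))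
    (by simpa only [hb, E3.inner_cross_right] using M.inner_map_map b (E3.cross a b))
  have hnn : inner ℝ (E3.cross a b) (E3.cross a b) ≠ 0 := inner_self_ne_zero.2 hn
  obtain ⟨k, hk⟩ : ∃ k : ℝ, M (E3.cross a b) = k • E3.cross a b := by
    refine ⟨(inner ℝ (E3.cross a b) (E3.cross a b))⁻¹ *
      inner ℝ (E3.cross a b) (M (E3.cross a b)), ?_⟩
    rw [mul_smul, ← hk, smul_smul, inv_mul_cancel₀ hnn, one_smul]
  let β := (EuclideanSpace.basisFun (Fin 3) ℝ).toBasis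
  let A := LinearMap.toMatrix β β (M.toLinearEquiv : E3 →ₗ[ℝ] E3)
  have hdet : LinearMap.det (M.toLinearEquiv : E3 →ₗ[ℝ] E3) = A.det :=
    (LinearMap.det_toMatrix β _).symm
  have hA : ∀ u : E3, A.mulVec u.ofLp = (M u).ofLp := fun u => by
    have := LinearMap.toMatrix_mulVec_repr β β (M.toLinearEquiv : E3 →ₗ[ℝ] E3) u
    have hβ : ∀ w : E3, ⇑(β.repr w) = w.ofLp := fun w => by ext i; simp [β]
    rwa [hβ, hβ] at this
  -- The columns are a, b and a × b, a basis of eigenvectors of `M`; the determinant of `B` is the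
  -- squared norm of a × b.
  let B : Matrix (Fin 3) (Fin 3) ℝ := Matrix.of fun i j => ![a, b, E3.cross a b] j i
  have hB : B.det ≠ 0 := by
    have : B.det = inner ℝ (E3.cross a b) (E3.cross a b) := by
      rw [E3.inner_eq, Matrix.det_fin_three]
      simp [B, E3.cross]
      ring
    rwa [this]
  have hAB : A * B = B * Matrix.diagonal ![1, 1, k] := by
    ext i j
    have h1 : (A * B) i j = A.mulVec (![a, b, E3.cross a b] j).ofLp i := rfl
    rw [h1, hA, Matrix.mul_diagonal]
    fin_cases j
    · simp [B, ha]
    · simp [B, hb]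
    · simp [B, hk, mul_comm]
  have hAk : A.det = k := by
    have := congrArg Matrix.det hAB
    rw [Matrix.det_mul, Matrix.det_mul, Matrix.det_diagonal, mul_comm] at this
    simpa [Fin.prod_univ_three] using mul_left_cancel₀ hB this
  rw [hdet, hAk]
  refine ⟨hk, ?_⟩
  rintro rfl
  have hA1 : A = 1 := by
    have h1 : A * B = 1 * B := by
      rw [hAB, one_mul]
      have : Matrix.diagonal ![(1 : ℝ), 1, 1] = 1 := by
        rw [← Matrix.diagonal_one]; congr 1; ext i; fin_cases i <;> rfl
      rw [this, mul_one]
    have hu : IsUnit B := (Matrix.isUnit_iff_isUnit_det B).2 (isUnit_iff_ne_zero.2 hB)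
    exact hu.mul_right_cancel h1
  ext u i
  have := hA u
  rw [hA1, Matrix.one_mulVec] at this
  exact (congrFun this i).symm

theorem LinearIsometryEquiv.det_eq_one_or_neg_one (M : E3 ≃ₗᵢ[ℝ] E3) :
    LinearMap.det (M.toLinearEquiv : E3 →ₗ[ℝ] E3) = 1 ∨
      LinearMap.det (M.toLinearEquiv : E3 →ₗ[ℝ] E3) = -1 := by
  apply eq_or_eq_neg_of_abs_eq
  rw [← LinearMap.normDet_eq_abs_det]
  exact M.toLinearIsometry.normDet_eq_one

theorem GoldenVec.toE3_cross (x y : GoldenVec) :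
    (cross x y).toE3 = E3.cross x.toE3 y.toE3 := by
  ext i; fin_cases i <;> simp [E3.cross, cross, toE3]

namespace PlatonicKind

open GoldenVec

/-- The vertices lie on one sphere about 0, so parallel ones are equal or opposite. -/
theorem cross_ne_zero (k : PlatonicKind) :
    ∀ x ∈ k.vecs, ∀ y ∈ k.vecs, x ≠ y → x ≠ -y → cross x y ≠ 0 := by
  cases k <;> decide +kernel

theorem dist_sq_toE3 (k : PlatonicKind) {x y : GoldenVec} (hx : x ∈ k.vecs) (hy : y ∈ k.vecs) :
    dist x.toE3 y.toE3 ^ 2 =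
      2 * (GoldenInt.toReal k.sqRadius - GoldenInt.toReal (gram x y)) := by
  rw [dist_eq_norm, norm_sub_sq_real, ← real_inner_self_eq_norm_sq, ← real_inner_self_eq_norm_sq,
    inner_toE3, inner_toE3, inner_toE3, k.gram_self x hx, k.gram_self y hy]
  ring

theorem toReal_gram_lt (k : PlatonicKind) {x y : GoldenVec} (hx : x ∈ k.vecs) (hy : y ∈ k.vecs)
    (hxy : x ≠ y) (hl : k.level (gram x y) ≠ 1) :
    GoldenInt.toReal (gram x y) < GoldenInt.toReal k.adjGram := by
  rcases k.level_eq_one_or x hx y hy with h | h | h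
  · exact absurd h hxy
  · exact absurd h.1 hl
  · have := GoldenInt.toReal_pos h.2.1 h.2.2
    rw [map_sub] at this
    linarith

theorem gram_eq_adjGram (k : PlatonicKind) {x y : GoldenVec} (hx : x ∈ k.vecs) (hy : y ∈ k.vecs)
    (hl : k.level (gram x y) = 1) : gram x y = k.adjGram := by
  rcases k.level_eq_one_or x hx y hy with h | h | h
  · subst h
    rw [k.gram_self x hx, k.level_sqRadius] at hl
    exact absurd hl zero_ne_one
  · exact h.2
  · exact absurd hl h.1

theorem ne_of_level_eq_one (k : PlatonicKind) {x y : GoldenVec} (hx : x ∈ k.vecs)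
    (hl : k.level (gram x y) = 1) : x ≠ y := by
  rintro rfl
  rw [k.gram_self x hx, k.level_sqRadius] at hl
  exact zero_ne_one hl

end PlatonicKind

/-! ### Combinatorial distance on a Platonic solid, and its center. -/

namespace PlatonicSolid

open GoldenVec

variable (S : PlatonicSolid)

/-- The point of the solid `S` that corresponds to a point of the standard model. -/
noncomputable def point (x : GoldenVec) : E3 := S.center + S.scale • S.iso x.toE3

theorem verts_eq : S.verts = S.point '' {x | x ∈ S.kind.vecs} := by
  rw [verts, PlatonicKind.modelVerts_eq, Set.image_image]
  rfl

theorem point_mem_verts {x : GoldenVec} (hx : x ∈ S.kind.vecs) : S.point x ∈ S.verts := by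
  rw [verts_eq]; exact ⟨x, hx, rfl⟩

theorem exists_point_eq {v : E3} (hv : v ∈ S.verts) : ∃ x ∈ S.kind.vecs, S.point x = v := by
  rwa [verts_eq] at hv

theorem dist_point (x y : GoldenVec) :
    dist (S.point x) (S.point y) = S.scale * dist x.toE3 y.toE3 := by
  rw [point, point, dist_add_left, dist_smul₀, S.iso.dist_map, Real.norm_of_nonneg S.scale_pos.le]

theorem point_injective : Function.Injective S.point := by
  intro x y h
  have h := S.dist_point x y ▸ dist_eq_zero.2 h
  exact toE3_injective (dist_eq_zero.1 ((mul_eq_zero.1 h).resolve_left S.scale_pos.ne'))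

theorem dist_point_le_iff {x y z w : GoldenVec} (hx : x ∈ S.kind.vecs) (hy : y ∈ S.kind.vecs)
    (hz : z ∈ S.kind.vecs) (hw : w ∈ S.kind.vecs) :
    dist (S.point x) (S.point y) ≤ dist (S.point z) (S.point w) ↔
      GoldenInt.toReal (gram z w) ≤ GoldenInt.toReal (gram x y) := by
  rw [dist_point, dist_point, mul_le_mul_iff_right₀ S.scale_pos,
    ← sq_le_sq₀ dist_nonneg dist_nonneg, S.kind.dist_sq_toE3 hx hy, S.kind.dist_sq_toE3 hz hw]
  constructor <;> intro h <;> linarith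

theorem adj_point_iff {x y : GoldenVec} (hx : x ∈ S.kind.vecs) (hy : y ∈ S.kind.vecs) :
    (minDistGraph S.verts).Adj (S.point x) (S.point y) ↔ S.kind.level (gram x y) = 1 := by
  constructor
  · rintro ⟨-, -, hne, h⟩
    by_contra hl
    -- A pair of level 1 is strictly closer than a pair of distinct vertices of any other level.
    obtain ⟨a, ha, b, hb, hab⟩ := S.kind.exists_adj_vecs
    have h1 := h _ (S.point_mem_verts ha) _ (S.point_mem_verts hb)
      (S.point_injective.ne (S.kind.ne_of_level_eq_one ha hab))
    rw [S.dist_point_le_iff hx hy ha hb, S.kind.gram_eq_adjGram ha hb hab] at h1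
    exact h1.not_gt (S.kind.toReal_gram_lt hx hy (fun h => hne (congrArg _ h)) hl)
  · intro hl
    refine ⟨S.point_mem_verts hx, S.point_mem_verts hy,
      S.point_injective.ne (S.kind.ne_of_level_eq_one hx hl), fun c hc d hd hcd => ?_⟩
    obtain ⟨c, hc', rfl⟩ := S.exists_point_eq hc
    obtain ⟨d, hd', rfl⟩ := S.exists_point_eq hd
    rw [S.dist_point_le_iff hx hy hc' hd', S.kind.gram_eq_adjGram hx hy hl]
    by_cases h : S.kind.level (gram c d) = 1
    · rw [S.kind.gram_eq_adjGram hc' hd' h]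
    · exact (S.kind.toReal_gram_lt hc' hd' (fun h => hcd (congrArg _ h)) h).le

theorem exists_walk {y : GoldenVec} (hy : y ∈ S.kind.vecs) (n : ℕ) :
    ∀ x ∈ S.kind.vecs, S.kind.level (gram x y) = n →
      ∃ p : (minDistGraph S.verts).Walk (S.point x) (S.point y), p.length = n := by
  induction n with
  | zero =>
    intro x hx h
    obtain rfl := S.kind.eq_of_level_eq_zero x hx y hy h
    exact ⟨.nil, rfl⟩
  | succ n ih =>
    intro x hx h
    have hne : x ≠ y := by
      rintro rfl
      rw [S.kind.gram_self x hx, S.kind.level_sqRadius] at h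
      exact Nat.succ_ne_zero n h.symm
    obtain ⟨z, hz, hxz, hzy⟩ := S.kind.exists_level_add_one x hx y hy hne
    obtain ⟨p, hp⟩ := ih z hz (by omega)
    exact ⟨.cons ((S.adj_point_iff hx hz).2 hxz) p, by simp [hp]⟩

/-- The endpoints are variables tied to model vertices by equations, so that induction on the walk
applies. -/
theorem level_le_length {y : GoldenVec} (hy : y ∈ S.kind.vecs) {u v : E3}
    (p : (minDistGraph S.verts).Walk u v) :
    v = S.point y → ∀ x ∈ S.kind.vecs, u = S.point x → S.kind.level (gram x y) ≤ p.length := by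
  induction p with
  | nil =>
    rintro rfl x hx h
    rw [S.point_injective h, S.kind.gram_self x hx, S.kind.level_sqRadius]
    exact Nat.zero_le _
  | cons h p ih =>
    rintro rfl x hx rfl
    obtain ⟨z, hz, rfl⟩ := S.exists_point_eq h.2.1
    have h1 := S.kind.level_le_level_add_one x hx z hz ((S.adj_point_iff hx hz).1 h) y hy
    have h2 := ih rfl z hz rfl
    rw [SimpleGraph.Walk.length_cons]
    omega

/-- The distance in the edge graph of a Platonic solid. -/
theorem dist_minDistGraph {x y : GoldenVec} (hx : x ∈ S.kind.vecs) (hy : y ∈ S.kind.vecs) :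
    (minDistGraph S.verts).dist (S.point x) (S.point y) = S.kind.level (gram x y) := by
  obtain ⟨p, hp⟩ := S.exists_walk hy _ x hx rfl
  refine le_antisymm (hp ▸ SimpleGraph.dist_le p) ?_
  obtain ⟨q, hq⟩ := (SimpleGraph.Walk.reachable p).exists_walk_length_eq_dist
  exact hq ▸ S.level_le_length hy q rfl x hx rfl

theorem diamond_point (μ : ℝ) (x : GoldenVec) :
    S.diamond μ (S.point x) = S.center + (μ * S.scale) • S.iso x.toE3 := by
  rw [diamond, AffineMap.homothety_apply, point, vsub_eq_sub, add_sub_cancel_left, vadd_eq_add,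
    smul_smul, add_comm]

theorem combLength_of_pos {μ : ℝ} (hμ : 0 < μ) {x y : GoldenVec} (hx : x ∈ S.kind.vecs)
    (hy : y ∈ S.kind.vecs) :
    S.combLength μ (S.point x) (S.point y) = S.kind.level (gram x y) := by
  rw [combLength, if_pos hμ, S.dist_minDistGraph hx hy]

/-- The cube whose vertices are those of the tetrahedra `S` and `-S`. -/
def circumscribedCube : PlatonicSolid where
  kind := .cube
  center := S.center
  scale := S.scale
  scale_pos := S.scale_pos
  iso := S.iso

theorem diamond_neg_one_point (x : GoldenVec) : S.diamond (-1) (S.point x) = S.point (-x) := by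
  rw [diamond_point, point, toE3_neg, map_neg, neg_one_mul, neg_smul, smul_neg]

theorem verts_circumscribedCube (hS : S.kind = .tetrahedron) :
    S.circumscribedCube.verts = S.verts ∪ S.diamond (-1) '' S.verts := by
  have h1 : ∀ x ∈ PlatonicKind.vecs .cube,
      x ∈ PlatonicKind.vecs .tetrahedron ∨ -x ∈ PlatonicKind.vecs .tetrahedron := by
    decide +kernel
  have h2 : ∀ x ∈ PlatonicKind.vecs .tetrahedron,
      x ∈ PlatonicKind.vecs .cube ∧ -x ∈ PlatonicKind.vecs .cube := by
    decide +kernel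
  rw [← hS] at h1 h2
  apply Set.Subset.antisymm
  · intro v hv
    obtain ⟨x, hx, rfl⟩ := S.circumscribedCube.exists_point_eq hv
    -- The cube has the center, scale and isometry of `S`, hence the same `point`.
    change S.point x ∈ _
    rcases h1 x hx with h | h
    · exact Or.inl (S.point_mem_verts h)
    · exact Or.inr ⟨_, S.point_mem_verts h, by rw [diamond_neg_one_point, neg_neg]⟩
  · rintro v (hv | ⟨v, hv, rfl⟩)
    · obtain ⟨x, hx, rfl⟩ := S.exists_point_eq hv
      exact S.circumscribedCube.point_mem_verts (h2 x hx).1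
    · obtain ⟨x, hx, rfl⟩ := S.exists_point_eq hv
      rw [diamond_neg_one_point]
      exact S.circumscribedCube.point_mem_verts (h2 x hx).2

/-- Distinct vertices of the tetrahedron have inner product -1, so x and -y have inner product 1,
that of adjacent vertices of the cube. -/
theorem combLength_opposed (hS : S.kind = .tetrahedron) {μ : ℝ} (hμ : μ < 0) {x y : GoldenVec}
    (hx : x ∈ S.kind.vecs) (hy : y ∈ S.kind.vecs) (hxy : x ≠ y) :
    S.combLength μ (S.point x) (S.point y) = 1 := by
  have h : ∀ x ∈ PlatonicKind.vecs .tetrahedron, ∀ y ∈ PlatonicKind.vecs .tetrahedron, x ≠ y →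
      x ∈ PlatonicKind.vecs .cube ∧ -y ∈ PlatonicKind.vecs .cube ∧
        PlatonicKind.level .cube (gram x (-y)) = 1 := by
    decide +kernel
  rw [hS] at hx hy
  obtain ⟨hx', hy', hl⟩ := h x hx y hy hxy
  rw [combLength, if_neg hμ.not_gt, ← S.verts_circumscribedCube hS, diamond_neg_one_point]
  exact (S.circumscribedCube.dist_minDistGraph hx' hy').trans hl

/-- An affine isometry that preserves the vertex set of a Platonic solid fixes its center. -/
theorem map_center {g : E3 ≃ᵃⁱ[ℝ] E3} (hg : ∀ v ∈ S.verts, g v ∈ S.verts) :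
    g S.center = S.center := by
  classical
  have hsum : ∑ x ∈ S.kind.vecs.toFinset, x.toE3 = 0 := by
    rw [List.sum_toFinset _ S.kind.nodup_vecs]
    have : ∀ l : List GoldenVec, (l.map toE3).sum = toE3 l.sum := by
      intro l
      induction l with
      | nil => simp [toE3_zero]
      | cons a l ih => rw [List.map_cons, List.sum_cons, ih, List.sum_cons, toE3_add]
    rw [this, S.kind.sum_vecs, toE3_zero]
  set T : Finset E3 := S.kind.vecs.toFinset.image S.point with hT
  have hTmem : ∀ v, v ∈ T ↔ v ∈ S.verts := by
    intro v; rw [verts_eq, hT]; simp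
  have hTsum : ∑ v ∈ T, (v - S.center) = 0 := by
    rw [hT, Finset.sum_image S.point_injective.injOn]
    simp only [point, add_sub_cancel_left]
    rw [← Finset.smul_sum, ← map_sum, hsum, map_zero, smul_zero]
  have himage : T.image g = T := by
    apply Finset.eq_of_subset_of_card_le
    · intro v hv
      obtain ⟨u, hu, rfl⟩ := Finset.mem_image.1 hv
      exact (hTmem _).2 (hg u ((hTmem u).1 hu))
    · rw [Finset.card_image_of_injective _ g.injective]
  -- As `g` permutes `T`, this sum is the image of the previous one under the linear part of `g`;
  -- comparing the two sums fixes the center.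
  have hTsum' : ∑ v ∈ T, (v - g S.center) = 0 := by
    have h1 : ∑ v ∈ T, (g v - g S.center) = 0 := by
      have : ∀ v, g v - g S.center = g.linearIsometryEquiv (v - S.center) := fun v =>
        (g.map_vsub v S.center).symm
      simp only [this]
      rw [← map_sum, hTsum, map_zero]
    conv_lhs => rw [← himage]
    rw [Finset.sum_image g.injective.injOn]
    exact h1
  have hcard : (T.card : ℝ) ≠ 0 := by
    obtain ⟨x, hx, -⟩ := S.kind.exists_adj_vecs
    exact Nat.cast_ne_zero.2
      (Finset.card_ne_zero_of_mem ((hTmem _).2 (S.point_mem_verts hx)))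
  have h2 : (T.card : ℝ) • (g S.center - S.center) = 0 := by
    have := congrArg₂ (· - ·) hTsum hTsum'
    simp only [← Finset.sum_sub_distrib, sub_sub_sub_cancel_left, sub_zero, Finset.sum_const] at this
    rwa [Nat.cast_smul_eq_nsmul]
  exact sub_eq_zero.1 ((smul_eq_zero.1 h2).resolve_left hcard)

end PlatonicSolid

/-! ### Symmetries in the coordinates of the model. -/

namespace PlatonicSolid

open GoldenVec

variable (S : PlatonicSolid) {g : E3 ≃ᵃⁱ[ℝ] E3}

/-- The linear part of an isometry, in the coordinates of the standard model of `S`. -/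
noncomputable def modelMap (g : E3 ≃ᵃⁱ[ℝ] E3) : E3 ≃ₗᵢ[ℝ] E3 :=
  (S.iso.trans g.linearIsometryEquiv).trans S.iso.symm

theorem map_of_map_center (hg : g S.center = S.center) (t : ℝ) (u : E3) :
    g (S.center + t • S.iso u) = S.center + t • S.iso (S.modelMap g u) := by
  have h := g.map_vadd S.center (t • S.iso u)
  rw [vadd_eq_add, vadd_eq_add, hg, map_smul, add_comm, add_comm _ S.center] at h
  rw [h]
  simp [modelMap]

/-- The factor t is free so that vertices of S and of S^◇ are governed by the same linear map. -/
theorem modelMap_eq_iff (hg : g S.center = S.center) {t : ℝ} (ht : t ≠ 0) {u u' : E3} :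
    g (S.center + t • S.iso u) = S.center + t • S.iso u' ↔ S.modelMap g u = u' := by
  rw [S.map_of_map_center hg, add_right_inj, smul_right_inj ht, S.iso.injective.eq_iff]

theorem map_point_eq_iff (hg : g S.center = S.center) {x x' : GoldenVec} :
    g (S.point x) = S.point x' ↔ S.modelMap g x.toE3 = x'.toE3 :=
  S.modelMap_eq_iff hg S.scale_pos.ne'

theorem map_diamond_point_eq_iff (hg : g S.center = S.center) {μ : ℝ} (hμ : μ ≠ 0)
    {x x' : GoldenVec} :
    g (S.diamond μ (S.point x)) = S.diamond μ (S.point x') ↔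
      S.modelMap g x.toE3 = x'.toE3 := by
  rw [diamond_point, diamond_point, S.modelMap_eq_iff hg (mul_ne_zero hμ S.scale_pos.ne')]

theorem eq_one_of_modelMap_eq_one (hg : g S.center = S.center) (h : S.modelMap g = 1) :
    g = 1 := by
  ext1 v
  have h1 := S.map_of_map_center hg 1 (S.iso.symm (v - S.center))
  rw [h] at h1
  simpa using h1

theorem det_modelMap (g : E3 ≃ᵃⁱ[ℝ] E3) :
    LinearMap.det ((S.modelMap g).toLinearEquiv : E3 →ₗ[ℝ] E3) =
      LinearMap.det (g.linearIsometryEquiv.toLinearEquiv : E3 →ₗ[ℝ] E3) :=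
  LinearMap.det_conj (g.linearIsometryEquiv.toLinearEquiv : E3 →ₗ[ℝ] E3)
    S.iso.symm.toLinearEquiv

theorem gram_eq_of_modelMap_eq {x y x' y' : GoldenVec} (hx : S.modelMap g x.toE3 = x'.toE3)
    (hy : S.modelMap g y.toE3 = y'.toE3) : gram x y = gram x' y' := by
  apply GoldenInt.toReal_injective
  rw [← inner_toE3, ← inner_toE3, ← hx, ← hy, LinearIsometryEquiv.inner_map_map]

end PlatonicSolid

/-! ### Edges of the polyhedron as pairs of model vertices. -/

namespace GeometricPolyhedron

open GoldenVec

section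

variable {P : GeometricPolyhedron} (hP : P.IsRegularOfIndexTwo) {S : PlatonicSolid} {μ : ℝ}
  (hμ : μ ≠ 0) (hS : P.IsVertexOrbit S.verts) (hSd : P.IsVertexOrbit (S.diamond μ '' S.verts))
  (hne : S.verts ≠ S.diamond μ '' S.verts) (hV : P.verts = S.verts ∪ S.diamond μ '' S.verts)

include hS in
theorem symmetry_map_center {g : E3 ≃ᵃⁱ[ℝ] E3} (hg : g ∈ P.symmetryGroup) :
    g S.center = S.center :=
  S.map_center fun _ hv => hS.map_mem hg hv

include hP hS hSd hne hV

theorem exists_eq_mk_point {e : Sym2 E3} (he : e ∈ P.edges) :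
    ∃ x ∈ S.kind.vecs, ∃ y ∈ S.kind.vecs, e = s(S.point x, S.diamond μ (S.point y)) := by
  obtain ⟨a, ha, b, hb, rfl⟩ := exists_eq_mk_of_mem_edges hP hS hSd hne hV he
  obtain ⟨x, hx, rfl⟩ := S.exists_point_eq ha
  obtain ⟨b, hb, rfl⟩ := hb
  obtain ⟨y, hy, rfl⟩ := S.exists_point_eq hb
  exact ⟨x, hx, y, hy, rfl⟩

include hμ

/-- All edges have the same inner product between their endpoints. -/
theorem gram_eq_of_edges {x y x' y' : GoldenVec} (hx : x ∈ S.kind.vecs) (hx' : x' ∈ S.kind.vecs)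
    (he : s(S.point x, S.diamond μ (S.point y)) ∈ P.edges)
    (he' : s(S.point x', S.diamond μ (S.point y')) ∈ P.edges) : gram x y = gram x' y' := by
  obtain ⟨g, hg, hgx, hgy⟩ := exists_symmetry_map_edge hP hS hSd hne hV he he'
    (S.point_mem_verts hx) (S.point_mem_verts hx')
  have hc := symmetry_map_center hS hg
  exact S.gram_eq_of_modelMap_eq ((S.map_point_eq_iff hc).1 hgx)
    ((S.map_diamond_point_eq_iff hc hμ).1 hgy)

/-- No edge lies on a line through the center. -/
theorem ne_and_ne_neg_of_edge {x y : GoldenVec}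
    (he : s(S.point x, S.diamond μ (S.point y)) ∈ P.edges) : x ≠ y ∧ x ≠ -y := by
  suffices h : ¬ (x = y ∨ x = -y) from not_or.1 h
  intro hxy
  obtain ⟨e', he', hve', hne'⟩ := exists_other_edge he (Sym2.mem_mk_left _ _)
  obtain ⟨g, hg, hgx, rfl⟩ := exists_symmetry_map_edge_at hP hS hSd hne hV he he'
    (Sym2.mem_mk_left _ _) hve'
  have hc := symmetry_map_center hS hg
  have hMx := (S.map_point_eq_iff hc).1 hgx
  -- A linear map fixing `x` fixes `y = ±x`, so the second edge at `x` would equal the first.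
  have hMy : S.modelMap g y.toE3 = y.toE3 := by
    rcases hxy with rfl | rfl
    · exact hMx
    · rwa [toE3_neg, map_neg, neg_inj] at hMx
  exact hne' (by rw [Sym2.map_mk, hgx, (S.map_diamond_point_eq_iff hc hμ).2 hMy])

theorem cross_ne_zero_of_edge {x y : GoldenVec} (hx : x ∈ S.kind.vecs) (hy : y ∈ S.kind.vecs)
    (he : s(S.point x, S.diamond μ (S.point y)) ∈ P.edges) :
    E3.cross x.toE3 y.toE3 ≠ 0 := by
  obtain ⟨h1, h2⟩ := ne_and_ne_neg_of_edge hP hμ hS hSd hne hV he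
  rw [← toE3_cross, ← toE3_zero]
  exact toE3_injective.ne (S.kind.cross_ne_zero x hx y hy h1 h2)

/-- Every edge is fixed pointwise by an improper symmetry. -/
theorem exists_improper_fixes_edge {x y : GoldenVec} (hx : x ∈ S.kind.vecs)
    (hy : y ∈ S.kind.vecs) (he : s(S.point x, S.diamond μ (S.point y)) ∈ P.edges) :
    ∃ g ∈ P.symmetryGroup, g (S.point x) = S.point x ∧
      g (S.diamond μ (S.point y)) = S.diamond μ (S.point y) ∧
      LinearMap.det (g.linearIsometryEquiv.toLinearEquiv : E3 →ₗ[ℝ] E3) = -1 := by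
  obtain ⟨g, hg, hgx, hgy, hg1⟩ := exists_ne_one_fixes_edge hP hS hSd hne hV he
  refine ⟨g, hg, hgx, hgy, g.linearIsometryEquiv.det_eq_one_or_neg_one.resolve_left fun h => ?_⟩
  have hc := symmetry_map_center hS hg
  refine hg1 (S.eq_one_of_modelMap_eq_one hc (((S.modelMap g).map_cross_of_fixes
    ((S.map_point_eq_iff hc).1 hgx) ((S.map_diamond_point_eq_iff hc hμ).1 hgy)
    (cross_ne_zero_of_edge hP hμ hS hSd hne hV hx hy he)).2 ?_))
  rw [S.det_modelMap, h]

/-- Existence: an improper symmetry between the edges is corrected by an improper one fixing the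
first edge. Uniqueness: a rotation preserving an edge cannot swap its ends, which lie in different
orbits, so it fixes two independent vectors and is trivial. -/
theorem rotationsSimplyEdgeTransitive : P.RotationsSimplyEdgeTransitive := by
  intro e he e' he'
  obtain ⟨x, hx, y, hy, rfl⟩ := exists_eq_mk_point hP hS hSd hne hV he
  obtain ⟨x', hx', y', hy', rfl⟩ := exists_eq_mk_point hP hS hSd hne hV he'
  apply existsUnique_of_exists_of_unique
  · obtain ⟨g, hg, hgx, hgy⟩ := exists_symmetry_map_edge hP hS hSd hne hV he he'
      (S.point_mem_verts hx) (S.point_mem_verts hx')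
    rcases g.linearIsometryEquiv.det_eq_one_or_neg_one with hdet | hdet
    · exact ⟨g, ⟨hg, hdet⟩, by rw [Sym2.map_mk, hgx, hgy]⟩
    · obtain ⟨h, hh, hhx, hhy, hhdet⟩ := exists_improper_fixes_edge hP hμ hS hSd hne hV hx hy he
      refine ⟨g * h, ⟨mul_mem hg hh, ?_⟩, ?_⟩
      · have := LinearMap.det_comp (g.linearIsometryEquiv.toLinearEquiv : E3 →ₗ[ℝ] E3)
          (h.linearIsometryEquiv.toLinearEquiv : E3 →ₗ[ℝ] E3)
        rw [hdet, hhdet, neg_one_mul, neg_neg] at this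
        exact this
      · rw [sym2_map_mul, Sym2.map_mk, hhx, hhy, Sym2.map_mk, hgx, hgy]
  · rintro g g' ⟨hg, hge⟩ ⟨hg', hge'⟩
    have hk : g⁻¹ * g' ∈ P.rotationGroup := mul_mem (inv_mem hg) hg'
    have hke : Sym2.map (g⁻¹ * g') s(S.point x, S.diamond μ (S.point y)) =
        s(S.point x, S.diamond μ (S.point y)) := by
      rw [sym2_map_mul, hge', ← hge, ← sym2_map_mul, inv_mul_cancel, sym2_map_one]
    have hkx : (g⁻¹ * g') (S.point x) = S.point x := by
      have hmem : (g⁻¹ * g') (S.point x) ∈ s(S.point x, S.diamond μ (S.point y)) := by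
        rw [← hke]
        exact Sym2.mem_map.2 ⟨_, Sym2.mem_mk_left _ _, rfl⟩
      refine (Sym2.mem_iff.1 hmem).resolve_right fun h => ?_
      refine Set.disjoint_left.1 (hS.disjoint hSd hne)
        (hS.map_mem hk.1 (S.point_mem_verts hx)) ?_
      rw [h]
      exact ⟨_, S.point_mem_verts hy, rfl⟩
    rw [Sym2.map_mk, hkx] at hke
    have hky := Sym2.congr_right.1 hke
    have hc := symmetry_map_center hS hk.1
    have h1 := S.eq_one_of_modelMap_eq_one hc (((S.modelMap _).map_cross_of_fixes
      ((S.map_point_eq_iff hc).1 hkx) ((S.map_diamond_point_eq_iff hc hμ).1 hky)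
      (cross_ne_zero_of_edge hP hμ hS hSd hne hV hx hy he)).2 (by rw [S.det_modelMap, hk.2]))
    exact inv_mul_eq_one.1 h1

/-- If `S` is a dodecahedron, the reflection that fixes an edge excludes the lengths 2 and 3. -/
theorem dodecahedron_gram_ne {x y : GoldenVec} (hk : S.kind = .dodecahedron)
    (hx : x ∈ S.kind.vecs) (hy : y ∈ S.kind.vecs)
    (he : s(S.point x, S.diamond μ (S.point y)) ∈ P.edges) :
    ¬ (gram x y = 1 ∨ gram x y = -1) := by
  intro hxy
  obtain ⟨g, hg, hgx, hgy, hdet⟩ := exists_improper_fixes_edge hP hμ hS hSd hne hV hx hy he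
  have hc := symmetry_map_center hS hg
  have hMx := (S.map_point_eq_iff hc).1 hgx
  have hMy := (S.map_diamond_point_eq_iff hc hμ).1 hgy
  obtain ⟨u, hu, hun, huniq⟩ :=
    PlatonicKind.dodecahedron_exists_rigid x (hk ▸ hx) y (hk ▸ hy) hxy
  rw [← hk] at hu
  obtain ⟨u', hu', hgu⟩ := S.exists_point_eq (hS.map_mem hg (S.point_mem_verts hu))
  have hMu := (S.map_point_eq_iff hc).1 hgu.symm
  obtain rfl := huniq u' (hk ▸ hu') (S.gram_eq_of_modelMap_eq hMu hMx).symm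
    (S.gram_eq_of_modelMap_eq hMu hMy).symm
  have hMn := ((S.modelMap g).map_cross_of_fixes hMx hMy
    (cross_ne_zero_of_edge hP hμ hS hSd hne hV hx hy he)).1
  rw [S.det_modelMap, hdet] at hMn
  -- The vertex is fixed while the normal of the plane is negated, so their inner product vanishes,
  -- although the vertex was chosen off the plane.
  have h := (S.modelMap g).inner_map_map u'.toE3 (E3.cross x.toE3 y.toE3)
  rw [hMu, hMn, inner_smul_right, ← toE3_cross, inner_toE3] at h
  have h0 : GoldenInt.toReal (gram u' (cross x y)) = 0 := by linarith
  exact hun (GoldenInt.toReal_injective (h0.trans (map_zero _).symm))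

/-- The solid `S` is not a cube, since the edge graph would be disconnected. -/
theorem kind_ne_cube : S.kind ≠ .cube := by
  intro hk
  -- Parity separates the two tetrahedra inscribed in the cube. Vertices neither equal nor opposite
  -- differ in one sign (inner product 1, parity changes) or two (inner product -1, parity kept).
  let parity : GoldenVec → GoldenInt := fun x => x.1 * x.2.1 * x.2.2
  have key : ∀ x ∈ PlatonicKind.vecs .cube, ∀ y ∈ PlatonicKind.vecs .cube, x ≠ y → x ≠ -y →
      parity y = -gram x y * parity x ∧ parity x = -gram x y * parity y ∧
        gram x y * gram x y = 1 := by
    decide +kernel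
  have h1 : ((1, 1, 1) : GoldenVec) ∈ S.kind.vecs := by rw [hk]; decide +kernel
  have h2 : ((-1, 1, 1) : GoldenVec) ∈ S.kind.vecs := by rw [hk]; decide +kernel
  have hp1 : parity (1, 1, 1) = 1 := by decide +kernel
  have hp2 : parity (-1, 1, 1) ≠ 1 := by decide +kernel
  rw [← hk] at key
  have hverts := hS.subset_verts
  obtain ⟨e₀, he₀, -⟩ := exists_edge_of_mem_verts (hverts (S.point_mem_verts h1))
  obtain ⟨x₀, hx₀, y₀, hy₀, rfl⟩ := exists_eq_mk_point hP hS hSd hne hV he₀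
  set γ := gram x₀ y₀
  have hedge : ∀ x ∈ S.kind.vecs, ∀ y ∈ S.kind.vecs,
      s(S.point x, S.diamond μ (S.point y)) ∈ P.edges →
      parity y = -γ * parity x ∧ parity x = -γ * parity y ∧ γ * γ = 1 := by
    intro x hx y hy he
    obtain ⟨ha, hb⟩ := ne_and_ne_neg_of_edge hP hμ hS hSd hne hV he
    have := key x hx y hy ha hb
    rwa [gram_eq_of_edges hP hμ hS hSd hne hV hx hx₀ he he₀] at this
  -- One inscribed tetrahedron from each cube, matched by the common inner product γ of the edges,
  -- so that no edge leaves `A`.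
  let A : Set E3 := {v | (∃ x ∈ S.kind.vecs, parity x = 1 ∧ S.point x = v) ∨
    ∃ y ∈ S.kind.vecs, parity y = -γ ∧ S.diamond μ (S.point y) = v}
  have hA : ∀ a b, s(a, b) ∈ P.edges → a ∈ A → b ∈ A := by
    rintro a b he (⟨x, hx, hpx, rfl⟩ | ⟨y, hy, hpy, rfl⟩)
    · obtain ⟨v, hv, rfl⟩ :=
        mem_right_orbit_of_edge hP hS hSd hne hV he (S.point_mem_verts hx)
      obtain ⟨y, hy, rfl⟩ := S.exists_point_eq hv
      refine Or.inr ⟨y, hy, ?_, rfl⟩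
      rw [(hedge x hx y hy he).1, hpx, mul_one]
    · have hb := mem_right_orbit_of_edge hP hSd hS hne.symm (hV.trans (Set.union_comm _ _)) he
        ⟨_, S.point_mem_verts hy, rfl⟩
      obtain ⟨x, hx, rfl⟩ := S.exists_point_eq hb
      rw [Sym2.eq_swap] at he
      obtain ⟨-, h, hγ⟩ := hedge x hx y hy he
      exact Or.inl ⟨x, hx, by rw [h, hpy, neg_mul_neg, hγ], rfl⟩
  have hsub := verts_subset_of_closed hA (hverts (S.point_mem_verts h1))
    (Or.inl ⟨_, h1, hp1, rfl⟩)
  rcases hsub (hverts (S.point_mem_verts h2)) with ⟨x, -, hpx, hxe⟩ | ⟨y, hy, -, hye⟩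
  · rw [S.point_injective hxe] at hpx
    exact hp2 hpx
  · exact Set.disjoint_left.1 (hS.disjoint hSd hne) (S.point_mem_verts h2)
      ⟨_, S.point_mem_verts hy, hye⟩

/-- If `S` and `S^◇` are aligned, then `P` has an edge length, which is the level of the inner
product of the endpoints of any edge. -/
theorem hasEdgeLength_of_pos (hpos : 0 < μ) {x y : GoldenVec} (hx : x ∈ S.kind.vecs)
    (he : s(S.point x, S.diamond μ (S.point y)) ∈ P.edges) :
    P.HasEdgeLength S μ (S.kind.level (gram x y)) := by
  intro e' he'
  obtain ⟨x', hx', y', hy', rfl⟩ := exists_eq_mk_point hP hS hSd hne hV he'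
  refine ⟨_, S.point_mem_verts hx', _, S.point_mem_verts hy', rfl, ?_⟩
  rw [S.combLength_of_pos hpos hx' hy', gram_eq_of_edges hP hμ hS hSd hne hV hx hx' he he']

theorem hasEdgeLength_of_neg (hneg : μ < 0) (hk : S.kind = .tetrahedron) :
    P.HasEdgeLength S μ 1 := by
  intro e he
  obtain ⟨x, hx, y, hy, rfl⟩ := exists_eq_mk_point hP hS hSd hne hV he
  exact ⟨_, S.point_mem_verts hx, _, S.point_mem_verts hy, rfl,
    S.combLength_opposed hk hneg hx hy (ne_and_ne_neg_of_edge hP hμ hS hSd hne hV he).1⟩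

end

end GeometricPolyhedron

open GoldenVec in
/-- The possible distances of two vertices of a Platonic solid that are neither equal nor
opposite. -/
theorem PlatonicKind.level_gram_of_ne (k : PlatonicKind) :
    ∀ x ∈ k.vecs, ∀ y ∈ k.vecs, x ≠ y → x ≠ -y →
      (k = .tetrahedron ∨ k = .octahedron → k.level (gram x y) = 1) ∧
      (k = .icosahedron → k.level (gram x y) = 1 ∨ k.level (gram x y) = 2) ∧
      (k = .dodecahedron → ¬ (gram x y = 1 ∨ gram x y = -1) →
        k.level (gram x y) = 1 ∨ k.level (gram x y) = 4) := by
  cases k <;> simp only [reduceCtorEq, or_false, or_true, false_imp_iff, and_true,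
    true_and, implies_true, forall_const] <;> decide +kernel

/-- `P` is a regular polyhedron of index 2 whose vertices form two orbits under `G(P)`, namely the
vertex set of a Platonic solid `S` and that of `S^◇`, where `S^◇ = μ S` is the image of `S` under
the homothety of ratio `μ` about the center of `S`; a negative ratio (`S^◇` opposed to `S`) is
allowed only for tetrahedra. -/
theorem lemma9 (P : GeometricPolyhedron) (hP : P.IsRegularOfIndexTwo)
    (S : PlatonicSolid) (μ : ℝ) (hμ : μ ≠ 0) (hopp : μ < 0 → S.kind = .tetrahedron)
    (hS : P.IsVertexOrbit S.verts) (hSd : P.IsVertexOrbit (S.diamond μ '' S.verts))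
    (hne : S.verts ≠ S.diamond μ '' S.verts)
    (hV : P.verts = S.verts ∪ S.diamond μ '' S.verts) :
    S.kind ≠ .cube ∧
    (S.kind = .tetrahedron ∨ S.kind = .octahedron → P.HasEdgeLength S μ 1) ∧
    (S.kind = .icosahedron → P.HasEdgeLength S μ 1 ∨ P.HasEdgeLength S μ 2) ∧
    (S.kind = .dodecahedron → P.HasEdgeLength S μ 1 ∨ P.HasEdgeLength S μ 4) ∧
    P.RotationsSimplyEdgeTransitive := by
  have hpos : S.kind ≠ .tetrahedron → 0 < μ := fun h =>
    lt_of_le_of_ne (not_lt.1 fun h' => h (hopp h')) hμ.symm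
  have hv : S.verts.Nonempty := by
    obtain ⟨x, hx, -⟩ := S.kind.exists_adj_vecs
    exact ⟨_, S.point_mem_verts hx⟩
  -- All edges share one inner product, so in the aligned case a single edge determines the edge
  -- length.
  obtain ⟨e, he, -⟩ := GeometricPolyhedron.exists_edge_of_mem_verts (hS.subset_verts hv.some_mem)
  obtain ⟨x, hx, y, hy, rfl⟩ := GeometricPolyhedron.exists_eq_mk_point hP hS hSd hne hV he
  obtain ⟨h1, h2⟩ := GeometricPolyhedron.ne_and_ne_neg_of_edge hP hμ hS hSd hne hV he
  obtain ⟨hto, hi, hd⟩ := S.kind.level_gram_of_ne x hx y hy h1 h2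
  have hlen := fun h => GeometricPolyhedron.hasEdgeLength_of_pos hP hμ hS hSd hne hV h hx he
  refine ⟨GeometricPolyhedron.kind_ne_cube hP hμ hS hSd hne hV, fun hk => ?_, fun hk => ?_,
    fun hk => ?_, GeometricPolyhedron.rotationsSimplyEdgeTransitive hP hμ hS hSd hne hV⟩
  · rcases lt_or_gt_of_ne hμ with hneg | h
    · exact GeometricPolyhedron.hasEdgeLength_of_neg hP hμ hS hSd hne hV hneg (hopp hneg)
    · exact hto hk ▸ hlen h
  · have hl := hlen (hpos (by simp [hk]))
    rcases hi hk with h | h <;> rw [h] at hl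
    exacts [Or.inl hl, Or.inr hl]
  · have hl := hlen (hpos (by simp [hk]))
    have hg := GeometricPolyhedron.dodecahedron_gram_ne hP hμ hS hSd hne hV hk hx hy he
    rcases hd hk hg with h | h <;> rw [h] at hl
    exacts [Or.inl hl, Or.inr hl]
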